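/- **Theorem (Relative apolarity lemma).** Let $\Bbbk$ be an algebraically closed field, let $V$ be a $\Bbbk$-vector space of dimension $n+1$, let $d\ge 0$ be an integer, and let $S^{(d)}V$ be the degree $d$ part of the divided power algebra of $V$, i.e. the dual space of $S^dV^*$. Let $Q$ be a $\Bbbk$-scheme with enough $\Bbbk$-points, i.e. $Q$ is locally Noetherian and for every point $w\in Q$ the closure $\overline{\{w\}}$ contains a $\Bbbk$-rational point. Let $F\colon Q\to \mathbb P_{\Bbbk}(S^{(d)}V)$ be a morphism of $\Bbbk$-schemes with graph $\overline F\subset \mathbb P_Q(S^{(d)}V)=Q\times_{\Bbbk}\mathbb P_{\Bbbk}(S^{(d)}V)$, and let $\mathcal R\subset \mathbb P_QV=Q\times_{\Bbbk}\mathbb P_{\Bbbk}V$ be a subscheme (a not necessarily flat family of subschemes over $Q$). Write $\nu_d\colon \mathbb P_QV\to\mathbb P_Q(S^{(d)}V)$ for the product of $\mathrm{id}_Q$ with the $d$-th Veronese map. For a family $\mathcal Y$ in $\mathbb P_QW$ let $\mathcal I(\mathcal Y)=\bigoplus_m\mathcal I(\mathcal Y)_m\subset\mathcal O_Q\otimes_{\Bbbk}\operatorname{Sym}W^*$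 be its homogeneous ideal sheaf, where $\mathcal I(\mathcal Y)_m$ consists of all forms of degree $m$ vanishing on $\mathcal Y$, and let the linear span $\langle\mathcal Y\rangle\subset\mathbb P_QW$ be the closed subscheme defined by the homogeneous ideal sheaf generated by $\mathcal I(\mathcal Y)_0$ and $\mathcal I(\mathcal Y)_1$. The relative annihilator $\operatorname{Ann}(F)\subset\mathcal O_Q\otimes_{\Bbbk}\operatorname{Sym}V^*$ is the quasi-coherent ideal sheaf whose restriction to any open $U\subset Q$ on which $F$ lifts to a nowhere vanishing section $F_\otimes\in\mathcal O_Q(U)\otimes_{\Bbbk}S^{(d)}V$ is $\{\Theta\mid \Theta\lrcorner F_\otimes=0\}$, where $(\Theta\lrcorner G)(\Psi)=G(\Theta\Psi)$ and $\mathcal O_Q\otimes_{\Bbbk}S^{(d)}V$ is viewed as the $\mathcal O_Q$-linear functionals on $\mathcal O_Q\otimes_{\Bbbk}\operatorname{Sym}V^*$ vanishing in degrees other than $d$. Then $\overline F\subset\langle\nu_d(\mathcal R)\rangle$ if and only if $\mathcal I(\mathcal R)\subset\operatorname{Ann}(F)$. -/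

import Mathlib

open CategoryTheory CategoryTheory.Limits AlgebraicGeometry

universe u

namespace RelApolarity

noncomputable section

section Proj

variable (k : Type u) [Field k] (τ : Type)

/-- The standard grading of the polynomial ring `k[x_i : i ∈ τ]`. -/
abbrev grading : ℕ → Submodule k (MvPolynomial τ k) := MvPolynomial.homogeneousSubmodule τ k

instance : GradedRing (grading k τ) := MvPolynomial.gradedAlgebra

/-- Projective space over `k` with homogeneous coordinates `x_i`, `i ∈ τ`. -/
abbrev ProjSpace : Scheme.{u} := Proj (grading k τ)

/-- The structure morphism of projective space. -/
def ProjSpace.toSpec : ProjSpace k τ ⟶ Spec (.of k) :=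
  Proj.toSpecZero (grading k τ) ≫
    Spec.map (CommRingCat.ofHom (algebraMap k (grading k τ 0)))

variable {τ}

lemma X_mem_grading (j : τ) : (MvPolynomial.X j : MvPolynomial τ k) ∈ grading k τ 1 :=
  MvPolynomial.isHomogeneous_X k j

/-- The standard chart `D₊(x_j)`. -/
abbrev chart (j : τ) : (ProjSpace k τ).Opens := Proj.basicOpen (grading k τ) (MvPolynomial.X j)

/-- The rational function `x_i / x_j`, as a section over `D₊(x_j)`. -/
def ratio (i j : τ) : Γ(ProjSpace k τ, chart k j) :=
  (Proj.awayToSection (grading k τ) (MvPolynomial.X j)).hom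
    (HomogeneousLocalization.Away.mk (grading k τ) (X_mem_grading k j) 1 (MvPolynomial.X i)
      (by simpa using X_mem_grading k i))

lemma irrelevant_le_span_X :
    (HomogeneousIdeal.irrelevant (grading k τ)).toIdeal ≤
      Ideal.span (Set.range (MvPolynomial.X : τ → MvPolynomial τ k)) := by
  intro p hp
  rw [← Set.image_univ, MvPolynomial.mem_ideal_span_X_image]
  intro m hm
  by_contra! H
  have hm0 : m = 0 := by ext i; simpa using H i
  subst hm0
  rw [MvPolynomial.mem_support_iff] at hm
  apply hm
  have := (HomogeneousIdeal.mem_irrelevant_iff _ _).mp hp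
  rw [GradedRing.proj_apply] at this
  have h2 : MvPolynomial.homogeneousComponent 0 p = 0 :=
    (MvPolynomial.decomposition.decompose'_apply p 0).symm.trans this
  simpa [MvPolynomial.homogeneousComponent_zero] using h2

/-- The standard affine cover of projective space by the charts `D₊(x_j)`. -/
def stdCover : (ProjSpace k τ).AffineOpenCover :=
  Proj.affineOpenCoverOfIrrelevantLESpan (grading k τ) (fun j : τ ↦ MvPolynomial.X j)
    (m := fun _ ↦ 1) (X_mem_grading k) (fun _ ↦ one_pos) (irrelevant_le_span_X k)

end Proj

section AwayEval

variable {k : Type u} [Field k] {τ : Type} {B C : Type u} [CommRing B] [CommRing C]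

/-- If `e : k[x] → B` sends the homogeneous polynomial `f` to a unit, this is the induced map
`k[x]_(f) → B`, `p / f ^ m ↦ e p / (e f) ^ m`. -/
def awayEval (e : MvPolynomial τ k →+* B) (f : MvPolynomial τ k) (h : IsUnit (e f)) :
    HomogeneousLocalization.Away (grading k τ) f →+* B :=
  (IsLocalization.Away.lift (S := Localization.Away f) f h).comp
    (algebraMap (HomogeneousLocalization.Away (grading k τ) f) (Localization.Away f))

lemma awayEval_mk_mul (e : MvPolynomial τ k →+* B) (f : MvPolynomial τ k) (h : IsUnit (e f))
    {m : ℕ} (hf : f ∈ grading k τ m) (r : ℕ) (p : MvPolynomial τ k) (hp : p ∈ grading k τ (r • m)) :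
    awayEval e f h (HomogeneousLocalization.Away.mk (grading k τ) hf r p hp) * e f ^ r = e p := by
  have h1 : IsLocalization.Away.lift (S := Localization.Away f) f h (algebraMap _ _ f) = e f :=
    IsLocalization.Away.lift_eq f h f
  have h2 : IsLocalization.Away.lift (S := Localization.Away f) f h (algebraMap _ _ p) = e p :=
    IsLocalization.Away.lift_eq f h p
  rw [← h1, ← h2, awayEval, RingHom.comp_apply, ← map_pow, ← map_mul]
  congr 1
  rw [HomogeneousLocalization.algebraMap_apply, HomogeneousLocalization.Away.val_mk,
    ← map_pow, ← Localization.mk_one_eq_algebraMap, ← Localization.mk_one_eq_algebraMap,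
    Localization.mk_mul, Localization.mk_eq_mk_iff, Localization.r_iff_exists]
  exact ⟨1, by simp [mul_comm]⟩

lemma awayEval_eq_of (e : MvPolynomial τ k →+* B) (f : MvPolynomial τ k) (h : IsUnit (e f))
    {m : ℕ} (hf : f ∈ grading k τ m) (ψ : HomogeneousLocalization.Away (grading k τ) f →+* B)
    (hψ : ∀ r p (hp : p ∈ grading k τ (r • m)),
      ψ (HomogeneousLocalization.Away.mk (grading k τ) hf r p hp) * e f ^ r = e p) :
    awayEval e f h = ψ := by
  ext z
  obtain ⟨r, p, hp, rfl⟩ := HomogeneousLocalization.Away.mk_surjective (grading k τ) hf z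
  rw [← (h.pow r).mul_left_inj, hψ r p hp]
  exact awayEval_mk_mul e f h hf r p hp

lemma comp_awayEval (e : MvPolynomial τ k →+* B) (f : MvPolynomial τ k) (h : IsUnit (e f))
    {m : ℕ} (hf : f ∈ grading k τ m) (ψ : B →+* C) :
    ψ.comp (awayEval e f h) = awayEval (ψ.comp e) f (h.map ψ) := by
  refine (awayEval_eq_of (ψ.comp e) f (h.map ψ) hf _ fun r p hp ↦ ?_).symm
  rw [RingHom.comp_apply, RingHom.comp_apply, RingHom.comp_apply, ← map_pow, ← map_mul]
  congr 1
  exact awayEval_mk_mul e f h hf r p hp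

lemma awayEval_congr (e e' : MvPolynomial τ k →+* B) (f : MvPolynomial τ k) (h : IsUnit (e f))
    (h' : IsUnit (e' f)) {m : ℕ} (hf : f ∈ grading k τ m) (u : B) (hu : IsUnit u)
    (H : ∀ r p, p ∈ grading k τ r → e' p = u ^ r * e p) :
    awayEval e f h = awayEval e' f h' := by
  refine awayEval_eq_of e f h hf _ fun r p hp ↦ ?_
  have := awayEval_mk_mul e' f h' hf r p hp
  rw [H _ p hp, H _ f hf, mul_pow, ← pow_mul, smul_eq_mul, mul_comm m r] at this
  rw [← (hu.pow (r * m)).mul_right_inj, ← this]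
  ring

lemma awayEval_comp_awayMap (e : MvPolynomial τ k →+* B) (f g : MvPolynomial τ k)
    (h : IsUnit (e f)) (h' : IsUnit (e (f * g))) {m m' : ℕ} (hf : f ∈ grading k τ m)
    (hg : g ∈ grading k τ m') :
    (awayEval e (f * g) h').comp (HomogeneousLocalization.awayMap (grading k τ) hg rfl) =
      awayEval e f h := by
  refine (awayEval_eq_of e f h hf _ fun r p hp ↦ ?_).symm
  rw [RingHom.comp_apply, HomogeneousLocalization.awayMap_mk]
  have h2 := awayEval_mk_mul e (f * g) h' (SetLike.mul_mem_graded hf hg) r (p * g ^ r)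
    (by rw [smul_add]; exact SetLike.mul_mem_graded hp (SetLike.pow_mem_graded _ hg))
  rw [map_mul, map_mul, mul_pow, map_pow] at h2
  rw [← ((isUnit_of_mul_isUnit_right (map_mul e f g ▸ h')).pow r).mul_left_inj, mul_assoc]
  exact h2

/-- The morphism `Spec B ⟶ Proj k[x]` attached to `e : k[x] → B` on the chart where `e f` is
invertible does not depend on the choice of `f`. -/
lemma specMap_awayEval (e : MvPolynomial τ k →+* B) (f g : MvPolynomial τ k)
    (h : IsUnit (e f)) (h' : IsUnit (e g)) {m m' : ℕ} (hf : f ∈ grading k τ m)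
    (hg : g ∈ grading k τ m') (hm : 0 < m) (hm' : 0 < m') :
    Spec.map (CommRingCat.ofHom (awayEval e f h)) ≫ Proj.awayι (grading k τ) f hf hm =
      Spec.map (CommRingCat.ofHom (awayEval e g h')) ≫ Proj.awayι (grading k τ) g hg hm' := by
  have hu : IsUnit (e (f * g)) := by rw [map_mul]; exact h.mul h'
  have hu' : IsUnit (e (g * f)) := by rw [map_mul]; exact h'.mul h
  rw [← awayEval_comp_awayMap e f g h hu hf hg, ← awayEval_comp_awayMap e g f h' hu' hg hf,
    CommRingCat.ofHom_comp, CommRingCat.ofHom_comp, Spec.map_comp, Spec.map_comp,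
    Category.assoc, Category.assoc, Proj.SpecMap_awayMap_awayι, Proj.SpecMap_awayMap_awayι]
  have key : ∀ (y : MvPolynomial τ k) (hy : y = f * g) (hyu : IsUnit (e y)) (my : ℕ)
      (hyd : y ∈ grading k τ my) (hmy : 0 < my),
      Spec.map (CommRingCat.ofHom (awayEval e (f * g) hu)) ≫
        Proj.awayι (grading k τ) (f * g) (SetLike.mul_mem_graded hf hg) (by omega) =
      Spec.map (CommRingCat.ofHom (awayEval e y hyu)) ≫ Proj.awayι (grading k τ) y hyd hmy := by
    rintro y rfl hyu my hyd hmy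
    rfl
  exact key (g * f) (mul_comm _ _) hu' _ _ _

end AwayEval

section Veronese

variable (k : Type u) [Field k] (σ : Type) (d : ℕ)

/-- The exponents of the monomials of degree `d` in the variables `α_i`, `i ∈ σ`. -/
abbrev DegIdx : Type := {a : σ →₀ ℕ // a.degree = d}

variable {σ}

/-- The exponent of `α_j ^ d`. -/
def powIdx (j : σ) : DegIdx σ d := ⟨Finsupp.single j d, by simp⟩

lemma monomial_mem (a : DegIdx σ d) :
    MvPolynomial.monomial a.1 (1 : k) ∈ grading k σ (d • 1) := by
  rw [smul_eq_mul, mul_one]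
  exact MvPolynomial.isHomogeneous_monomial _ a.2

/-- The element `α ^ a / α_j ^ d` of `k[α]_(α_j)`. -/
def verCoord (j : σ) (a : DegIdx σ d) :
    HomogeneousLocalization.Away (grading k σ) (MvPolynomial.X j) :=
  HomogeneousLocalization.Away.mk (grading k σ) (X_mem_grading k j) d
    (MvPolynomial.monomial a.1 1) (monomial_mem k d a)

/-- The homomorphism `k[y_a : |a| = d] → k[α]_(α_j)`, `y_a ↦ α ^ a / α_j ^ d`. -/
def verEval (j : σ) : MvPolynomial (DegIdx σ d) k →+*
    HomogeneousLocalization.Away (grading k σ) (MvPolynomial.X j) :=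
  MvPolynomial.eval₂Hom
    ((HomogeneousLocalization.fromZeroRingHom (grading k σ) _).comp (algebraMap k (grading k σ 0)))
    (verCoord k d j)

lemma verEval_powIdx (j : σ) : verEval k d j (MvPolynomial.X (powIdx d j)) = 1 := by
  rw [verEval, MvPolynomial.eval₂Hom_X']
  apply HomogeneousLocalization.val_injective
  rw [verCoord, HomogeneousLocalization.Away.val_mk, HomogeneousLocalization.val_one]
  simp [powIdx, ← MvPolynomial.X_pow_eq_monomial]

/-- The Veronese map on the chart `D₊(α_j)`, in coordinates `y_a = α ^ a / α_j ^ d`. -/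
def verChart (j : σ) :
    Spec (.of (HomogeneousLocalization.Away (grading k σ) (MvPolynomial.X j))) ⟶
      ProjSpace k (DegIdx σ d) :=
  Spec.map (CommRingCat.ofHom (awayEval (verEval k d j) (MvPolynomial.X (powIdx d j))
      (by rw [verEval_powIdx]; exact isUnit_one))) ≫
    Proj.awayι (grading k (DegIdx σ d)) (MvPolynomial.X (powIdx d j)) (X_mem_grading k _) one_pos

/-- The ring map `k[y] → k[α]_(α_j α_l)`, `y_a ↦ α ^ a / α_j ^ d`, where `x = α_j α_l`. -/
def verEval₂ (j l : σ) (x : MvPolynomial σ k) (hx : x = MvPolynomial.X j * MvPolynomial.X l) :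
    MvPolynomial (DegIdx σ d) k →+* HomogeneousLocalization.Away (grading k σ) x :=
  (HomogeneousLocalization.awayMap (grading k σ) (X_mem_grading k l) hx).comp (verEval k d j)

lemma verEval₂_X (j l : σ) (x : MvPolynomial σ k)
    (hx : x = MvPolynomial.X j * MvPolynomial.X l) (a : DegIdx σ d) :
    (verEval₂ k d j l x hx (MvPolynomial.X a)).val *
        algebraMap (MvPolynomial σ k) (Localization.Away x) (MvPolynomial.X j) ^ d =
      algebraMap (MvPolynomial σ k) (Localization.Away x) (MvPolynomial.monomial a.1 1) := by
  rw [verEval₂, RingHom.comp_apply, verEval, MvPolynomial.eval₂Hom_X', verCoord,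
    HomogeneousLocalization.awayMap_mk, HomogeneousLocalization.Away.val_mk,
    ← map_pow, ← Localization.mk_one_eq_algebraMap, ← Localization.mk_one_eq_algebraMap,
    Localization.mk_mul, Localization.mk_eq_mk_iff, Localization.r_iff_exists]
  exact ⟨1, by simp [hx]; ring⟩

lemma verEval₂_X_eq (j l : σ) (x : MvPolynomial σ k)
    (hx : x = MvPolynomial.X j * MvPolynomial.X l) (hx' : x = MvPolynomial.X l * MvPolynomial.X j)
    (a : DegIdx σ d) :
    verEval₂ k d j l x hx (MvPolynomial.X a) =
      verEval₂ k d j l x hx (MvPolynomial.X (powIdx d l)) *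
        verEval₂ k d l j x hx' (MvPolynomial.X a) := by
  have hu (i : σ) (hi : (MvPolynomial.X i : MvPolynomial σ k) ∣ x) :
      IsUnit (algebraMap (MvPolynomial σ k) (Localization.Away x) (MvPolynomial.X i)) := by
    refine isUnit_of_dvd_unit ?_ (IsLocalization.Away.algebraMap_isUnit (S := Localization.Away x) x)
    exact map_dvd _ hi
  have huj := (hu j ⟨_, hx⟩).pow d
  have hul := (hu l ⟨_, hx'⟩).pow d
  apply HomogeneousLocalization.val_injective
  rw [HomogeneousLocalization.val_mul, ← huj.mul_left_inj, verEval₂_X, mul_right_comm, verEval₂_X,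
    powIdx]
  dsimp only
  rw [← MvPolynomial.X_pow_eq_monomial, map_pow, mul_comm, verEval₂_X]

lemma verEval₂_homogeneous (j l : σ) (x : MvPolynomial σ k)
    (hx : x = MvPolynomial.X j * MvPolynomial.X l) (hx' : x = MvPolynomial.X l * MvPolynomial.X j)
    (r : ℕ) (p : MvPolynomial (DegIdx σ d) k) (hp : p ∈ grading k (DegIdx σ d) r) :
    verEval₂ k d j l x hx p =
      verEval₂ k d j l x hx (MvPolynomial.X (powIdx d l)) ^ r * verEval₂ k d l j x hx' p := by
  have hC (c : k) : verEval₂ k d j l x hx (MvPolynomial.C c) =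
      verEval₂ k d l j x hx' (MvPolynomial.C c) := by
    simp only [verEval₂, verEval, RingHom.comp_apply, MvPolynomial.eval₂Hom_C]
    rw [HomogeneousLocalization.awayMap_fromZeroRingHom,
      HomogeneousLocalization.awayMap_fromZeroRingHom]
  rw [p.as_sum, map_sum, map_sum, Finset.mul_sum]
  refine Finset.sum_congr rfl fun b hb ↦ ?_
  have hb' : b.degree = r := by
    have := hp (MvPolynomial.mem_support_iff.mp hb)
    rwa [Finsupp.degree_eq_weight_one]
  rw [MvPolynomial.monomial_eq, map_mul, map_mul, hC, Finsupp.prod, map_prod, map_prod,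
    mul_left_comm]
  congr 1
  rw [← hb', Finsupp.degree_apply, ← Finset.prod_pow_eq_pow_sum, ← Finset.prod_mul_distrib]
  refine Finset.prod_congr rfl fun a _ ↦ ?_
  rw [map_pow, map_pow, ← mul_pow, ← verEval₂_X_eq]

lemma specMap_verChart (j l : σ) (x : MvPolynomial σ k)
    (hx : x = MvPolynomial.X j * MvPolynomial.X l)
    (hx' : x = MvPolynomial.X l * MvPolynomial.X j) :
    Spec.map (CommRingCat.ofHom
        (HomogeneousLocalization.awayMap (grading k σ) (X_mem_grading k l) hx)) ≫ verChart k d j =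
      Spec.map (CommRingCat.ofHom
        (HomogeneousLocalization.awayMap (grading k σ) (X_mem_grading k j) hx')) ≫
        verChart k d l := by
  have hj : verEval₂ k d j l x hx (MvPolynomial.X (powIdx d j)) = 1 := by
    rw [verEval₂, RingHom.comp_apply, verEval_powIdx, map_one]
  have hl : verEval₂ k d l j x hx' (MvPolynomial.X (powIdx d l)) = 1 := by
    rw [verEval₂, RingHom.comp_apply, verEval_powIdx, map_one]
  have hu : IsUnit (verEval₂ k d j l x hx (MvPolynomial.X (powIdx d l))) := by
    refine IsUnit.of_mul_eq_one _ ((verEval₂_X_eq k d j l x hx hx' (powIdx d j)).symm.trans hj)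
  rw [verChart, verChart, ← Category.assoc, ← Category.assoc, ← Spec.map_comp, ← Spec.map_comp,
    ← CommRingCat.ofHom_comp, ← CommRingCat.ofHom_comp,
    comp_awayEval _ _ _ (X_mem_grading k _), comp_awayEval _ _ _ (X_mem_grading k _)]
  change Spec.map (CommRingCat.ofHom (awayEval (verEval₂ k d j l x hx) _
      (by rw [hj]; exact isUnit_one))) ≫ _ =
    Spec.map (CommRingCat.ofHom (awayEval (verEval₂ k d l j x hx') _
      (by rw [hl]; exact isUnit_one))) ≫ _
  rw [specMap_awayEval (verEval₂ k d j l x hx) (MvPolynomial.X (powIdx d j))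
    (MvPolynomial.X (powIdx d l)) _ hu (X_mem_grading k _) (X_mem_grading k _) one_pos one_pos]
  congr 3
  exact (awayEval_congr _ _ _ _ _ (X_mem_grading k _) _ hu
    fun r p hp ↦ verEval₂_homogeneous k d j l x hx hx' r p hp).symm

variable (σ) in
/-- The Veronese map `ν_d : ℙ V → ℙ (S^(d) V)`, in coordinates `y_a = α ^ a` for `|a| = d`. -/
def veronese : ProjSpace k σ ⟶ ProjSpace k (DegIdx σ d) :=
  (stdCover k (τ := σ)).openCover.glueMorphisms (fun j : σ ↦ verChart k d j) fun (j l : σ) ↦ by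
    have h1 := Proj.pullbackAwayιIso_hom_SpecMap_awayMap_left (grading k σ) (X_mem_grading k j)
      one_pos (X_mem_grading k l) one_pos rfl
    have h2 := Proj.pullbackAwayιIso_hom_SpecMap_awayMap_right (grading k σ) (X_mem_grading k j)
      one_pos (X_mem_grading k l) one_pos rfl
    change pullback.fst (Proj.awayι (grading k σ) (MvPolynomial.X j) (X_mem_grading k j) one_pos)
        (Proj.awayι (grading k σ) (MvPolynomial.X l) (X_mem_grading k l) one_pos) ≫ verChart k d j =
      pullback.snd _ _ ≫ verChart k d l
    rw [← h1, ← h2, Category.assoc, Category.assoc,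
      specMap_verChart k d j l _ rfl (mul_comm _ _)]

lemma awayι_veronese (j : σ) :
    Proj.awayι (grading k σ) (MvPolynomial.X j) (X_mem_grading k j) one_pos ≫ veronese k σ d =
      verChart k d j :=
  (stdCover k (τ := σ)).openCover.ι_glueMorphisms _ _ j

lemma veronese_toSpec :
    veronese k σ d ≫ ProjSpace.toSpec k (DegIdx σ d) = ProjSpace.toSpec k σ := by
  refine (stdCover k (τ := σ)).openCover.hom_ext _ _ fun (j : σ) ↦ ?_
  change Proj.awayι (grading k σ) (MvPolynomial.X j) (X_mem_grading k j) one_pos ≫ _ =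
    Proj.awayι (grading k σ) (MvPolynomial.X j) (X_mem_grading k j) one_pos ≫ _
  rw [← Category.assoc, awayι_veronese, verChart, ProjSpace.toSpec, ProjSpace.toSpec,
    Category.assoc, ← Category.assoc (Proj.awayι _ _ _ _), Proj.awayι_toSpecZero,
    ← Category.assoc (Proj.awayι _ _ _ _), Proj.awayι_toSpecZero, ← Spec.map_comp,
    ← Spec.map_comp, ← Spec.map_comp]
  congr 1
  rw [← CommRingCat.ofHom_comp, ← CommRingCat.ofHom_comp, ← CommRingCat.ofHom_comp]
  congr 1
  ext c
  simp only [RingHom.comp_apply]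
  have h0 : HomogeneousLocalization.fromZeroRingHom (grading k (DegIdx σ d))
      (.powers (MvPolynomial.X (powIdx d j))) (algebraMap k (grading k (DegIdx σ d) 0) c) =
      HomogeneousLocalization.Away.mk (grading k (DegIdx σ d)) (X_mem_grading k (powIdx d j)) 0
        (MvPolynomial.C c) (by simp) := by
    apply HomogeneousLocalization.val_injective
    rw [HomogeneousLocalization.Away.val_mk]
    refine Localization.mk_eq_mk_iff.mpr ((Localization.r_iff_exists).mpr ⟨1, ?_⟩)
    simp [MvPolynomial.algebraMap_eq]
  have h1 := awayEval_mk_mul (verEval k d j) (MvPolynomial.X (powIdx d j))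
    (by rw [verEval_powIdx]; exact isUnit_one) (X_mem_grading k (powIdx d j)) 0
        (MvPolynomial.C c) (by simp)
  rw [pow_zero, mul_one] at h1
  erw [h0, h1]
  simp [verEval]

end Veronese

section Relative

variable {k : Type u} [Field k] {Q : Scheme.{u}} (s : Q ⟶ Spec (.of k))

/-- The `k`-scheme `Q` has enough `k`-points: it is locally Noetherian, and the closure of every
point of `Q` contains a `k`-rational point. -/
structure HasEnoughPoints : Prop where
  isLocallyNoetherian : IsLocallyNoetherian Q
  exists_point : ∀ w : Q, ∃ x : Spec (.of k) ⟶ Q, x ≫ s = 𝟙 _ ∧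
    x (IsLocalRing.closedPoint k) ∈ closure {w}

variable (τ : Type)

/-- Relative projective space `ℙ_Q W = Q ×_k ℙ_k W` with homogeneous coordinates `x_i`, `i ∈ τ`. -/
abbrev RelProj : Scheme.{u} := pullback s (ProjSpace.toSpec k τ)

variable {τ}

section Forms

variable {s} {T : Scheme.{u}} (f : T ⟶ RelProj s τ) (U : Q.Opens)

/-- The part of `T` lying over `U ⊆ Q` and over the chart `D₊(x_j)`. -/
def preChart (j : τ) : T.Opens :=
  (f ≫ pullback.fst _ _) ⁻¹ᵁ U ⊓ (f ≫ pullback.snd _ _) ⁻¹ᵁ chart k j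

/-- For a form `Θ` of degree `m` with coefficients in `𝒪_Q(U)`, the pullback to `T` of the
function `Θ / x_j ^ m = Θ (x_i / x_j)_i` on `U × D₊(x_j)`. -/
def pullbackForm (j : τ) (Θ : MvPolynomial τ Γ(Q, U)) : Γ(T, preChart f U j) :=
  MvPolynomial.eval₂
    ((f ≫ pullback.fst _ _).appLE U (preChart f U j) inf_le_left).hom
    (fun i ↦ ((f ≫ pullback.snd _ _).appLE (chart k j) (preChart f U j) inf_le_right).hom
      (ratio k i j)) Θ

/-- The form `Θ` vanishes on `T`. -/
def VanishesOn (Θ : MvPolynomial τ Γ(Q, U)) : Prop :=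
  ∀ j : τ, pullbackForm f U j Θ = 0

/-- The homogeneous ideal sheaf in `𝒪_Q[x_i : i ∈ τ]` of a family of subschemes of `ℙ_Q W`: over
an affine open `U`, it is generated by the forms of all degrees that vanish on the family. (For
general `f : T ⟶ ℙ_Q W`, the forms vanishing on the scheme-theoretic image.) -/
def homogeneousIdeal (U : Q.affineOpens) : Ideal (MvPolynomial τ Γ(Q, U)) :=
  Ideal.span {Θ | (∃ m, Θ.IsHomogeneous m) ∧ VanishesOn f U Θ}

/-- The linear ideal sheaf generated by the parts of degrees `0` and `1` of `homogeneousIdeal`. -/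
def linearIdeal (U : Q.affineOpens) : Ideal (MvPolynomial τ Γ(Q, U)) :=
  Ideal.span {Θ | Θ ∈ homogeneousIdeal f U ∧ ∃ m ≤ 1, Θ.IsHomogeneous m}

end Forms

variable {s} in
/-- The ideal sheaf on `ℙ_Q W` of the vanishing scheme of a family of homogeneous ideals
`J U ⊆ 𝒪_Q(U)[x_i : i ∈ τ]`: the smallest ideal sheaf, hence the largest closed subscheme,
such that all forms in all `J U` vanish on the subscheme. -/
def vanishingIdealSheaf (J : ∀ U : Q.affineOpens, Ideal (MvPolynomial τ Γ(Q, U))) :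
    (RelProj s τ).IdealSheafData :=
  sInf {K | ∀ (U : Q.affineOpens) (Θ : MvPolynomial τ Γ(Q, U)), Θ ∈ J U →
    (∃ m, Θ.IsHomogeneous m) → VanishesOn K.subschemeι U Θ}

variable {s} in
/-- The (projective, equation) linear span of a family of subschemes `f : T ⟶ ℙ_Q W`. -/
def linearSpan {T : Scheme.{u}} (f : T ⟶ RelProj s τ) : Scheme.{u} :=
  (vanishingIdealSheaf (s := s) (linearIdeal f)).subscheme

variable {s} in
/-- The inclusion of the linear span in `ℙ_Q W`. -/
def linearSpanι {T : Scheme.{u}} (f : T ⟶ RelProj s τ) : linearSpan f ⟶ RelProj s τ :=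
  (vanishingIdealSheaf (s := s) (linearIdeal f)).subschemeι

/-- The graph `Q ⟶ ℙ_Q W` of a `k`-morphism `F : Q ⟶ ℙ_k W`. -/
def graph (F : Q ⟶ ProjSpace k τ) (hF : F ≫ ProjSpace.toSpec k τ = s) : Q ⟶ RelProj s τ :=
  pullback.lift (𝟙 Q) F (by rw [Category.id_comp, hF])

/-- The relative Veronese map `id_Q × ν_d : ℙ_Q V ⟶ ℙ_Q (S^(d) V)`. -/
def relVeronese (σ : Type) (d : ℕ) : RelProj s σ ⟶ RelProj s (DegIdx σ d) :=
  pullback.lift (pullback.fst _ _) (pullback.snd _ _ ≫ veronese k σ d)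
    (by rw [Category.assoc, veronese_toSpec, pullback.condition])

/-- The homomorphism `k → Γ(X, 𝒪_X)` of a `k`-scheme `X`. -/
def scalars {X : Scheme.{u}} (t : X ⟶ Spec (.of k)) : k →+* Γ(X, ⊤) :=
  ((Scheme.ΓSpecIso (.of k)).inv ≫ t.appTop).hom

/-- The tuple `T ∈ Γ(X, 𝒪_X) ⊗ W` of functions, regarded as a morphism from `X` to the affine space
of `W`, avoids the origin and lifts the morphism `G : X ⟶ ℙ_k W`; that is, the coordinates of `T`
have no common zero, and `G = [T]`. -/
def IsLift {X : Scheme.{u}} (t : X ⟶ Spec (.of k)) (G : X ⟶ ProjSpace k τ) (T : τ → Γ(X, ⊤)) :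
    Prop :=
  ∃ h : (HomogeneousIdeal.irrelevant (grading k τ)).toIdeal.map
      (MvPolynomial.eval₂Hom (scalars t) T) = ⊤,
    G = Proj.fromOfGlobalSections (grading k τ) (MvPolynomial.eval₂Hom (scalars t) T) h

end Relative

section Apolarity

variable {A : Type u} [CommRing A] {σ : Type}

/-- The apolarity action of `A[α]` on `∏ i, A ⊗ S^(i) V = Hom_A (A[α], A)`:
`(Θ ⌟ G) Ψ = G (Θ * Ψ)`. -/
def apolar (Θ : MvPolynomial σ A) (G : MvPolynomial σ A →ₗ[A] A) : MvPolynomial σ A →ₗ[A] A :=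
  G ∘ₗ LinearMap.mulLeft A Θ

lemma apolar_apply (Θ Ψ : MvPolynomial σ A) (G : MvPolynomial σ A →ₗ[A] A) :
    apolar Θ G Ψ = G (Θ * Ψ) := rfl

open Classical in
/-- The element `∑ a, T a • x^(a)` of `A ⊗ S^(d) V ⊆ Hom_A (A[α], A)`, where the divided power
monomials `x^(a)` are dual to the monomials `α ^ a`. -/
def tensor {d : ℕ} (T : DegIdx σ d → A) : MvPolynomial σ A →ₗ[A] A :=
  (MvPolynomial.basisMonomials σ A).constr A
    (fun a ↦ if h : a.degree = d then T ⟨a, h⟩ else 0)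

end Apolarity

section Annihilator

variable {k : Type u} [Field k] {Q : Scheme.{u}} (s : Q ⟶ Spec (.of k)) {σ : Type} {d : ℕ}

/-- The restriction homomorphism `𝒪_Q(U) → Γ(U', 𝒪_U')` for opens `U' ⊆ U` of `Q`. -/
def restrictTo {U U' : Q.Opens} (h : U' ≤ U) : Γ(Q, U) →+* Γ(U', ⊤) :=
  (Q.presheaf.map (homOfLE h).op ≫ U'.topIso.inv).hom

/-- The relative annihilator `Ann(F) ⊆ 𝒪_Q ⊗ Sym V^*` of `F : Q ⟶ ℙ (S^(d) V)`: the sections over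
an affine open `U` are the `Θ` with `Θ ⌟ T = 0` for every open `U' ⊆ U` and every lift `T` of
`F|_U'` to the affine space of `S^(d) V`. -/
def ann (F : Q ⟶ ProjSpace k (DegIdx σ d)) (U : Q.affineOpens) :
    Ideal (MvPolynomial σ Γ(Q, U)) where
  carrier := {Θ | ∀ (U' : Q.Opens) (h : U' ≤ U) (T : DegIdx σ d → Γ(U', ⊤)),
    IsLift (U'.ι ≫ s) (U'.ι ≫ F) T →
      apolar (MvPolynomial.map (restrictTo h) Θ) (tensor T) = 0}
  zero_mem' U' h T _ := by
    refine LinearMap.ext fun p ↦ ?_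
    rw [map_zero, apolar_apply, zero_mul, map_zero, LinearMap.zero_apply]
  add_mem' {Θ₁ Θ₂} h₁ h₂ U' h T hT := by
    refine LinearMap.ext fun p ↦ ?_
    rw [map_add, apolar_apply, add_mul, map_add, ← apolar_apply, ← apolar_apply, h₁ U' h T hT,
      h₂ U' h T hT, LinearMap.zero_apply, add_zero]
  smul_mem' c Θ hΘ U' h T hT := by
    refine LinearMap.ext fun p ↦ ?_
    rw [smul_eq_mul, map_mul, apolar_apply, mul_comm (MvPolynomial.map _ c), mul_assoc,
      ← apolar_apply, hΘ U' h T hT, LinearMap.zero_apply, LinearMap.zero_apply]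

end Annihilator
end
end RelApolarity

/-!
Write `ν` for the relative Veronese map, and `ν(R)` for its composite with `i`. The substitution `y_a ↦ α ^ a`
(`veroneseForm`) identifies linear forms in the coordinates `y_a` of `ℙ_Q (S^(d) V)` with forms of
degree `d` in the `α_i`, and `Λ` vanishes on `ν(R)` if and only if `Λ(α ^ a)` vanishes on `R`
(`vanishesOn_veroneseForm`, `vanishesOn_relVeronese`). On the other hand, if `T` is a local lift of
`F` to affine space, then `Λ(T)` is the value of the functional `∑ a, T a • x^(a)` at `Λ(α ^ a)`
(`eval₂Hom_eq_tensor`), and `Λ` vanishes on the graph of `F` if and only if `Λ(T) = 0` for all local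
lifts (`eval₂Hom_eq_zero_of_vanishesOn_graph`, `vanishesOn_graph_of_eval₂Hom_eq_zero`).

If the graph lies in the span and `Θ` is a form vanishing on `R`, then `Θ α ^ b` vanishes on `R`
for every monomial `α ^ b`. When it has degree `d` it corresponds to a linear form that vanishes on
`ν(R)`, hence on the span and on the graph, so `T` kills `Θ α ^ b`; in other degrees this is
trivial. So `Θ ⌟ T = 0`. Conversely, if `I(R) ⊆ Ann(F)`, a linear form vanishing on `ν(R)`
corresponds to a form of degree `d` in `I(R)`; it annihilates all local lifts `T`, so `T`
kills it, and the linear form vanishes on the graph. Forms of degree `0` are reduced to degree `1`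
by multiplication by a coordinate.

The geometric input is that the forms generating the linear ideal do vanish on the linear span
(`vanishesOn_linearSpanι`). The span is defined by the smallest ideal sheaf on whose zero scheme
these forms vanish, and one has to see that they vanish on the zero scheme of the infimum. This
holds when they generate the same ideal in every stalk, whichever affine open of `Q` they are taken
over (`subschemeι_sInf_app_eq_zero`); and that in turn follows since a form over `D(h) ⊆ U`
vanishing on the family extends to `U` after multiplication by a power of `h`
(`exists_vanishesOn_extension`). The extension uses that the pieces of the family over the standard
charts are compact, which is where the Noetherian hypothesis enters
(`isCompact_preChart_relVeronese`). Lifts of a morphism to `ℙ W` are compared with the functions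
`x_i / x_j` in `IsLift.ratio_eq` and `isLift_ratio`.
-/

namespace RelApolarity

noncomputable section

/-! ### Ideal sheaves generated by compatible families of sections -/

lemma exists_affineOpens_mem_le {X : Scheme.{u}} {U : X.Opens} {p : X} (hp : p ∈ U) :
    ∃ V : X.affineOpens, p ∈ V.1 ∧ V.1 ≤ U := by
  obtain ⟨V, hV, hpV, hle⟩ := exists_isAffineOpen_mem_and_subset hp
  exact ⟨⟨V, hV⟩, hpV, hle⟩

lemma res_res {X : Scheme.{u}} {U V W : X.Opens} (h₁ : U ≤ V) (h₂ : V ≤ W) (x : Γ(X, W)) :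
    (X.presheaf.map (homOfLE h₁).op).hom ((X.presheaf.map (homOfLE h₂).op).hom x) =
      (X.presheaf.map (homOfLE (h₁.trans h₂)).op).hom x := by
  rw [← CommRingCat.comp_apply, ← Functor.map_comp]
  rfl

section Glue

variable {X : Scheme.{u}} {ι : Type*} (W : ι → X.Opens) (G : ∀ i, Set Γ(X, W i))

/-- The ideal generated by the germs at `p` of the sections `G i ⊆ 𝒪(W i)`. -/
def stalkSpan (i : ι) (p : X) (hp : p ∈ W i) : Ideal (X.presheaf.stalk p) :=
  Ideal.span ((X.presheaf.germ (W i) p hp).hom '' G i)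

/-- The sections over an affine open `V` whose germ at each point `p ∈ V` lies in all the ideals
`stalkSpan W G i p`. -/
def stalkwiseIdeal (V : X.affineOpens) : Ideal Γ(X, V) :=
  ⨅ (i : ι) (p : X) (hV : p ∈ V.1) (hi : p ∈ W i),
    (stalkSpan W G i p hi).comap (X.presheaf.germ V.1 p hV).hom

lemma mem_stalkwiseIdeal {V : X.affineOpens} {x : Γ(X, V)} :
    x ∈ stalkwiseIdeal W G V ↔ ∀ (i : ι) (p : X) (hV : p ∈ V.1) (hi : p ∈ W i),
      X.presheaf.germ V.1 p hV x ∈ stalkSpan W G i p hi := by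
  simp only [stalkwiseIdeal, Ideal.mem_iInf, Ideal.mem_comap]

/-- The sets of sections `G i` generate the same ideal in every stalk. -/
def StalkCompatible : Prop :=
  ∀ (i j : ι) (p : X) (hi : p ∈ W i) (hj : p ∈ W j),
    stalkSpan W G i p hi ≤ stalkSpan W G j p hj

variable {W G}

lemma map_germ_span_res {V : X.Opens} {i : ι} (h : V ≤ W i) (p : X) (hp : p ∈ V) :
    (Ideal.span ((X.presheaf.map (homOfLE h).op).hom '' G i)).map
      (X.presheaf.germ V p hp).hom = stalkSpan W G i p (h hp) := by
  rw [Ideal.map_span, stalkSpan, Set.image_image]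
  congr 1
  refine Set.image_congr fun g _ ↦ ?_
  exact X.presheaf.germ_res_apply (homOfLE h) p hp g

lemma stalkwiseIdeal_eq_span (H : StalkCompatible W G) (V : X.affineOpens) {i : ι}
    (h : V.1 ≤ W i) :
    stalkwiseIdeal W G V = Ideal.span ((X.presheaf.map (homOfLE h).op).hom '' G i) := by
  ext x
  rw [mem_stalkwiseIdeal, V.2.mem_ideal_iff (I := Ideal.span _)]
  constructor
  · intro hx p hp
    rw [map_germ_span_res h]
    exact hx i p hp (h hp)
  · intro hx j p hp hj
    have := hx p hp
    rw [map_germ_span_res h] at this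
    exact H i j p (h hp) hj this

lemma stalkwiseIdeal_res {V V' : X.affineOpens} (h : V'.1 ≤ V.1) {x : Γ(X, V)}
    (hx : x ∈ stalkwiseIdeal W G V) :
    (X.presheaf.map (homOfLE h).op).hom x ∈ stalkwiseIdeal W G V' := by
  rw [mem_stalkwiseIdeal] at hx ⊢
  intro i p hp hi
  have := hx i p (h hp) hi
  rwa [← X.presheaf.germ_res_apply (homOfLE h) p hp x] at this

lemma mem_stalkwiseIdeal_of_cover {V : X.affineOpens} {x : Γ(X, V)}
    (hx : ∀ p ∈ V.1, ∃ (V' : X.affineOpens) (h : V'.1 ≤ V.1), p ∈ V'.1 ∧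
      (X.presheaf.map (homOfLE h).op).hom x ∈ stalkwiseIdeal W G V') :
    x ∈ stalkwiseIdeal W G V := by
  rw [mem_stalkwiseIdeal]
  intro i p hp hi
  obtain ⟨V', h, hp', hx'⟩ := hx p hp
  rw [mem_stalkwiseIdeal] at hx'
  have := hx' i p hp' hi
  rwa [← X.presheaf.germ_res_apply (homOfLE h) p hp' x]

lemma exists_pow_mul_mem_stalkwiseIdeal_of_le (H : StalkCompatible W G) (V : X.affineOpens) {i : ι}
    (h : V.1 ≤ W i) (f y : Γ(X, V))
    (hy : (X.presheaf.map (homOfLE (X.basicOpen_le f)).op).hom y ∈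
      stalkwiseIdeal W G (X.affineBasicOpen f)) :
    ∃ N : ℕ, f ^ N * y ∈ stalkwiseIdeal W G V := by
  have hloc := V.2.isLocalization_basicOpen f
  rw [stalkwiseIdeal_eq_span H _ ((X.basicOpen_le f).trans h)] at hy
  have e : Ideal.span ((X.presheaf.map (homOfLE ((X.basicOpen_le f).trans h)).op).hom '' G i) =
      (stalkwiseIdeal W G V).map (algebraMap Γ(X, V) Γ(X, X.basicOpen f)) := by
    rw [stalkwiseIdeal_eq_span H _ h, Ideal.map_span, Set.image_image]
    congr 1
    refine Set.image_congr fun g _ ↦ ?_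
    rw [RingHom.algebraMap_toAlgebra]
    rw [← CommRingCat.comp_apply, ← Functor.map_comp]
    rfl
  have hy' : algebraMap Γ(X, V) Γ(X, X.basicOpen f) y ∈
      (stalkwiseIdeal W G V).map (algebraMap Γ(X, V) Γ(X, X.basicOpen f)) := e ▸ hy
  obtain ⟨_, ⟨N, rfl⟩, hN⟩ :=
    (IsLocalization.algebraMap_mem_map_algebraMap_iff (.powers f) _ _ _).mp hy'
  exact ⟨N, hN⟩

/-- A section over an affine open `V` that is stalkwise in the ideal on the basic open `D(f)` is so
on all of `V` after multiplication by a power of `f`: this is quasi-coherence. -/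
lemma exists_pow_mul_mem_stalkwiseIdeal (H : StalkCompatible W G) (hW : ⨆ i, W i = ⊤)
    (V : X.affineOpens) (f y : Γ(X, V))
    (hy : (X.presheaf.map (homOfLE (X.basicOpen_le f)).op).hom y ∈
      stalkwiseIdeal W G (X.affineBasicOpen f)) :
    ∃ N : ℕ, f ^ N * y ∈ stalkwiseIdeal W G V := by
  have key : ∀ p : V.1, ∃ (V' : X.affineOpens) (h : V'.1 ≤ V.1) (N : ℕ), p.1 ∈ V'.1 ∧
      (X.presheaf.map (homOfLE h).op).hom (f ^ N * y) ∈ stalkwiseIdeal W G V' := by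
    rintro ⟨p, hp⟩
    obtain ⟨i, hi⟩ := TopologicalSpace.Opens.mem_iSup.mp (hW.ge (Set.mem_univ p))
    obtain ⟨V', hpV', hle⟩ := exists_affineOpens_mem_le (U := V.1 ⊓ W i) ⟨hp, hi⟩
    have h : V'.1 ≤ V.1 := hle.trans inf_le_left
    obtain ⟨N, hN⟩ := exists_pow_mul_mem_stalkwiseIdeal_of_le H V' (hle.trans inf_le_right)
      ((X.presheaf.map (homOfLE h).op).hom f) ((X.presheaf.map (homOfLE h).op).hom y) (by
        have hb : X.basicOpen ((X.presheaf.map (homOfLE h).op).hom f) ≤ X.basicOpen f := by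
          erw [X.basicOpen_res]
          exact inf_le_right
        have := stalkwiseIdeal_res (V := X.affineBasicOpen f)
          (V' := X.affineBasicOpen (U := V') ((X.presheaf.map (homOfLE h).op).hom f)) hb hy
        have e := (res_res (X.basicOpen_le ((X.presheaf.map (homOfLE h).op).hom f)) h y).trans
          (res_res hb (X.basicOpen_le f) y).symm
        exact e ▸ this)
    exact ⟨V', h, N, hpV', by rwa [map_mul, map_pow]⟩
  choose V' hle N hmem hN using key
  obtain ⟨t, hcov⟩ := V.2.isCompact.elim_nhds_subcover' (fun p hp ↦ ((V' ⟨p, hp⟩).1 : Set X))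
    (fun p hp ↦ (V' ⟨p, hp⟩).1.2.mem_nhds (hmem ⟨p, hp⟩))
  refine ⟨t.sup N, mem_stalkwiseIdeal_of_cover fun p hp ↦ ?_⟩
  obtain ⟨q, hq, hpq⟩ := Set.mem_iUnion₂.mp (hcov hp)
  refine ⟨V' q, hle q, hpq, ?_⟩
  obtain ⟨m, hm⟩ := Nat.exists_eq_add_of_le (Finset.le_sup (f := N) hq)
  rw [hm, pow_add, mul_right_comm, map_mul]
  exact Ideal.mul_mem_right _ _ (hN q)

/-- The ideal sheaf generated by the sections in the sets `G i`. -/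
def glueIdeal (H : StalkCompatible W G) (hW : ⨆ i, W i = ⊤) : X.IdealSheafData where
  ideal := stalkwiseIdeal W G
  map_ideal_basicOpen V f := by
    refine le_antisymm (Ideal.map_le_iff_le_comap.mpr fun x hx ↦ stalkwiseIdeal_res _ hx) ?_
    intro x hx
    have hloc := V.2.isLocalization_basicOpen f
    obtain ⟨⟨y, ⟨_, n, rfl⟩⟩, hy⟩ := IsLocalization.surj (Submonoid.powers f)
      (S := Γ(X, X.basicOpen f)) x
    have hy' : (X.presheaf.map (homOfLE (X.basicOpen_le f)).op).hom y ∈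
      stalkwiseIdeal W G (X.affineBasicOpen f) := by
      rw [RingHom.algebraMap_toAlgebra] at hy
      exact hy ▸ Ideal.mul_mem_right _ (stalkwiseIdeal W G (X.affineBasicOpen f)) hx
    obtain ⟨N, hN⟩ := exists_pow_mul_mem_stalkwiseIdeal H hW V f y hy'
    have h2 := Ideal.mem_map_of_mem (algebraMap Γ(X, V) Γ(X, X.basicOpen f)) hN
    rw [map_mul, ← hy, mul_left_comm, ← map_mul] at h2
    have hu : IsUnit (algebraMap Γ(X, V) Γ(X, X.basicOpen f) (f ^ N * f ^ n)) := by
      rw [← pow_add, map_pow]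
      exact (IsLocalization.Away.algebraMap_isUnit f).pow _
    exact (Ideal.mul_unit_mem_iff_mem _ hu).mp h2

end Glue

section Vanishing

variable {X : Scheme.{u}}

lemma subschemeι_app_eq_zero_iff (K : X.IdealSheafData) {W : X.Opens} (g : Γ(X, W)) :
    (K.subschemeι.app W).hom g = 0 ↔ ∀ (V : X.affineOpens) (h : V.1 ≤ W),
      (X.presheaf.map (homOfLE h).op).hom g ∈ K.ideal V := by
  have key (V : X.affineOpens) (h : V.1 ≤ W) :
      (X.presheaf.map (homOfLE h).op).hom g ∈ K.ideal V ↔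
        (K.subscheme.presheaf.map (homOfLE (K.subschemeι.preimage_mono h)).op).hom
          ((K.subschemeι.app W).hom g) = 0 := by
    rw [← K.ker_subschemeι_app, RingHom.mem_ker, ← CommRingCat.comp_apply,
      ← CommRingCat.comp_apply, Scheme.Hom.naturality]
    rfl
  constructor
  · intro hg V h
    rw [key, hg, map_zero]
  · intro hg
    refine K.subscheme.IsSheaf.section_ext fun p hp ↦ ?_
    obtain ⟨V, hpV, hle⟩ := exists_affineOpens_mem_le (U := W) (p := K.subschemeι p) hp
    refine ⟨_, K.subschemeι.preimage_mono hle, hpV, ?_⟩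
    rw [map_zero]
    exact (key V hle).mp (hg V hle)

/-- If the sections in the sets `G i` generate the same ideal in every stalk, then there is a
largest closed subscheme on which all of them vanish: the smallest ideal sheaf cutting it out. -/
theorem subschemeι_sInf_app_eq_zero {ι : Type*} {W : ι → X.Opens} {G : ∀ i, Set Γ(X, W i)}
    (H : StalkCompatible W G) (hW : ⨆ i, W i = ⊤) {i : ι} {g : Γ(X, W i)} (hg : g ∈ G i) :
    ((sInf {K : X.IdealSheafData | ∀ i, ∀ g ∈ G i,
      (K.subschemeι.app (W i)).hom g = 0}).subschemeι.app (W i)).hom g = 0 := by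
  have hle : glueIdeal H hW ≤ sInf {K : X.IdealSheafData | ∀ i, ∀ g ∈ G i,
      (K.subschemeι.app (W i)).hom g = 0} := by
    refine le_sInf fun K hK V x hx ↦ ?_
    rw [V.2.mem_ideal_iff]
    intro p hp
    obtain ⟨j, hj⟩ := TopologicalSpace.Opens.mem_iSup.mp (hW.ge (Set.mem_univ p))
    refine (Ideal.span_le (I := (K.ideal V).map _)).mpr ?_
      ((mem_stalkwiseIdeal W G).mp hx j p hp hj)
    rintro _ ⟨g, hg, rfl⟩
    obtain ⟨V', hpV', hle⟩ := exists_affineOpens_mem_le (U := V.1 ⊓ W j) ⟨hp, hj⟩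
    have h1 := (subschemeι_app_eq_zero_iff K g).mp (hK j g hg) V' (hle.trans inf_le_right)
    have h2 : V' ≤ V := hle.trans inf_le_left
    rw [← K.map_ideal h2] at h1
    have h3 := Ideal.mem_map_of_mem (X.presheaf.germ V'.1 p hpV').hom h1
    have e : X.presheaf.map (homOfLE h2).op ≫ X.presheaf.germ V'.1 p hpV' =
      X.presheaf.germ V.1 p hp := X.presheaf.germ_res (homOfLE (show V'.1 ≤ V.1 from h2)) p hpV'
    rw [Ideal.map_map, ← CommRingCat.hom_comp, e] at h3
    exact (X.presheaf.germ_res_apply (homOfLE (hle.trans inf_le_right)) p hpV' g) ▸ h3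
  rw [subschemeι_app_eq_zero_iff]
  intro V h
  refine hle V ?_
  change _ ∈ stalkwiseIdeal W G V
  rw [stalkwiseIdeal_eq_span H V h]
  exact Ideal.subset_span ⟨g, hg, rfl⟩

end Vanishing

/-! ### Evaluation of forms in the standard charts -/

section EvalForm

lemma eval₂Hom_of_isHomogeneous {τ : Type*} {A B : Type*} [CommRing A] [CommRing B] (φ : A →+* B)
    (x y : τ → B) (u : B) (h : ∀ i, x i = u * y i) {m : ℕ} {Θ : MvPolynomial τ A}
    (hΘ : Θ.IsHomogeneous m) :
    MvPolynomial.eval₂Hom φ x Θ = u ^ m * MvPolynomial.eval₂Hom φ y Θ := by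
  rw [MvPolynomial.coe_eval₂Hom, MvPolynomial.coe_eval₂Hom, MvPolynomial.eval₂_eq,
    MvPolynomial.eval₂_eq, Finset.mul_sum]
  refine Finset.sum_congr rfl fun b hb ↦ ?_
  have hb' : b.degree = m := by
    have := hΘ (MvPolynomial.mem_support_iff.mp hb)
    rwa [Finsupp.degree_eq_weight_one]
  rw [mul_left_comm, ← hb', Finsupp.degree_apply, ← Finset.prod_pow_eq_pow_sum,
    ← Finset.prod_mul_distrib]
  simp_rw [h, mul_pow]

variable {k : Type u} [Field k] {τ : Type}

lemma ratio_self (j : τ) : ratio k j j = 1 := by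
  rw [ratio, ← map_one (Proj.awayToSection (grading k τ) (MvPolynomial.X j)).hom]
  congr 1
  apply HomogeneousLocalization.val_injective
  rw [HomogeneousLocalization.Away.val_mk, HomogeneousLocalization.val_one]
  simp

lemma ratio_mul_ratio (i j l : τ) {P : (ProjSpace k τ).Opens} (hj : P ≤ chart k j)
    (hl : P ≤ chart k l) :
    ((ProjSpace k τ).presheaf.map (homOfLE hj).op).hom (ratio k i j) =
      ((ProjSpace k τ).presheaf.map (homOfLE hj).op).hom (ratio k l j) *
        ((ProjSpace k τ).presheaf.map (homOfLE hl).op).hom (ratio k i l) := by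
  have hP : P ≤ Proj.basicOpen (grading k τ) (MvPolynomial.X j * MvPolynomial.X l) := by
    rw [Proj.basicOpen_mul]
    exact le_inf hj hl
  have key (i j l : τ) (x : MvPolynomial τ k) (hx : x = MvPolynomial.X j * MvPolynomial.X l)
      (hP : P ≤ Proj.basicOpen (grading k τ) x) (hj : P ≤ chart k j) :
      ((ProjSpace k τ).presheaf.map (homOfLE hj).op).hom (ratio k i j) =
        ((ProjSpace k τ).presheaf.map (homOfLE hP).op).hom
          ((Proj.awayToSection (grading k τ) x).hom
            (HomogeneousLocalization.awayMap (grading k τ) (X_mem_grading k l) hx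
              (HomogeneousLocalization.Away.mk (grading k τ) (X_mem_grading k j) 1
                (MvPolynomial.X i) (by simpa using X_mem_grading k i)))) := by
    have := congr($(Proj.awayMap_awayToSection (grading k τ) (f := MvPolynomial.X j)
      (X_mem_grading k l) hx).hom (HomogeneousLocalization.Away.mk (grading k τ)
        (X_mem_grading k j) 1 (MvPolynomial.X i) (by simpa using X_mem_grading k i)))
    rw [CommRingCat.hom_comp, CommRingCat.hom_comp, RingHom.comp_apply, RingHom.comp_apply,
      CommRingCat.hom_ofHom] at this
    rw [this, res_res]
    rfl
  rw [key i j l _ rfl hP hj, key l j l _ rfl hP hj, key i l j _ (mul_comm _ _) hP hl,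
    ← map_mul, ← map_mul]
  congr 2
  apply HomogeneousLocalization.val_injective
  rw [HomogeneousLocalization.val_mul, HomogeneousLocalization.awayMap_mk,
    HomogeneousLocalization.awayMap_mk, HomogeneousLocalization.awayMap_mk,
    HomogeneousLocalization.Away.val_mk, HomogeneousLocalization.Away.val_mk,
    HomogeneousLocalization.Away.val_mk, Localization.mk_mul, Localization.mk_eq_mk_iff,
    Localization.r_iff_exists]
  exact ⟨1, by simp; ring⟩

variable {T Q : Scheme.{u}}

/-- For morphisms `a : T ⟶ Q` and `b : T ⟶ ℙ W` and an open `P ⊆ T` lying over `U` and over the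
chart `D₊(x_j)`, the homomorphism `𝒪_Q(U)[x] → 𝒪_T(P)` given by `a` on coefficients and by
`x_i ↦ b^* (x_i / x_j)` on variables. -/
def evalForm (a : T ⟶ Q) (b : T ⟶ ProjSpace k τ) (U : Q.Opens) (j : τ) (P : T.Opens)
    (h₁ : P ≤ a ⁻¹ᵁ U) (h₂ : P ≤ b ⁻¹ᵁ chart k j) : MvPolynomial τ Γ(Q, U) →+* Γ(T, P) :=
  MvPolynomial.eval₂Hom (a.appLE U P h₁).hom
    (fun i ↦ (b.appLE (chart k j) P h₂).hom (ratio k i j))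

variable (a : T ⟶ Q) (b : T ⟶ ProjSpace k τ) {U U' : Q.Opens} (j l : τ) {P P' : T.Opens}
    (h₁ : P ≤ a ⁻¹ᵁ U) (h₂ : P ≤ b ⁻¹ᵁ chart k j)

lemma evalForm_res (h : P' ≤ P) (Θ : MvPolynomial τ Γ(Q, U)) :
    (T.presheaf.map (homOfLE h).op).hom (evalForm a b U j P h₁ h₂ Θ) =
      evalForm a b U j P' (h.trans h₁) (h.trans h₂) Θ := by
  have e : ((T.presheaf.map (homOfLE h).op).hom).comp (evalForm a b U j P h₁ h₂) =
      evalForm a b U j P' (h.trans h₁) (h.trans h₂) := by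
    refine MvPolynomial.ringHom_ext (fun c ↦ ?_) (fun i ↦ ?_)
    · simp only [evalForm, RingHom.comp_apply, MvPolynomial.eval₂Hom_C]
      rw [← CommRingCat.comp_apply, Scheme.Hom.appLE_map]
    · simp only [evalForm, RingHom.comp_apply, MvPolynomial.eval₂Hom_X']
      rw [← CommRingCat.comp_apply, Scheme.Hom.appLE_map]
  exact congr($e Θ)

lemma appLE_evalForm {T' : Scheme.{u}} (g : T' ⟶ T) {P' : T'.Opens} (h : P' ≤ g ⁻¹ᵁ P)
    (h₁' : P' ≤ (g ≫ a) ⁻¹ᵁ U) (h₂' : P' ≤ (g ≫ b) ⁻¹ᵁ chart k j) (Θ : MvPolynomial τ Γ(Q, U)) :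
    (g.appLE P P' h).hom (evalForm a b U j P h₁ h₂ Θ) =
      evalForm (g ≫ a) (g ≫ b) U j P' h₁' h₂' Θ := by
  have e : ((g.appLE P P' h).hom).comp (evalForm a b U j P h₁ h₂) =
      evalForm (g ≫ a) (g ≫ b) U j P' h₁' h₂' := by
    refine MvPolynomial.ringHom_ext (fun c ↦ ?_) (fun i ↦ ?_)
    · simp only [evalForm, RingHom.comp_apply, MvPolynomial.eval₂Hom_C]
      rw [← CommRingCat.comp_apply, Scheme.Hom.appLE_comp_appLE]
    · simp only [evalForm, RingHom.comp_apply, MvPolynomial.eval₂Hom_X']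
      rw [← CommRingCat.comp_apply, Scheme.Hom.appLE_comp_appLE]
  exact congr($e Θ)

lemma evalForm_map_coeff (h : U' ≤ U) (h₁' : P ≤ a ⁻¹ᵁ U') (Θ : MvPolynomial τ Γ(Q, U)) :
    evalForm a b U' j P h₁' h₂ (MvPolynomial.map (Q.presheaf.map (homOfLE h).op).hom Θ) =
      evalForm a b U j P h₁ h₂ Θ := by
  have e : (evalForm a b U' j P h₁' h₂).comp
      (MvPolynomial.map (Q.presheaf.map (homOfLE h).op).hom) = evalForm a b U j P h₁ h₂ := by
    refine MvPolynomial.ringHom_ext (fun c ↦ ?_) (fun i ↦ ?_)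
    · simp only [evalForm, RingHom.comp_apply, MvPolynomial.map_C, MvPolynomial.eval₂Hom_C]
      rw [← CommRingCat.comp_apply, Scheme.Hom.map_appLE]
    · simp only [evalForm, RingHom.comp_apply, MvPolynomial.map_X, MvPolynomial.eval₂Hom_X']
  exact congr($e Θ)

lemma appLE_ratio (i : τ) (h₂' : P ≤ b ⁻¹ᵁ chart k l) :
    (b.appLE (chart k j) P h₂).hom (ratio k i j) =
      (b.appLE (chart k j) P h₂).hom (ratio k l j) *
        (b.appLE (chart k l) P h₂').hom (ratio k i l) := by
  have h : P ≤ b ⁻¹ᵁ (chart k j ⊓ chart k l) := le_inf h₂ h₂'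
  have := congr((b.appLE _ P h).hom $(ratio_mul_ratio (k := k) i j l (P := chart k j ⊓ chart k l)
    inf_le_left inf_le_right))
  rw [map_mul] at this
  simp only [← CommRingCat.comp_apply, Scheme.Hom.map_appLE] at this
  exact this

/-- Change of chart: `Θ / x_j ^ m = (x_l / x_j) ^ m * (Θ / x_l ^ m)`. -/
lemma evalForm_chart (h₂' : P ≤ b ⁻¹ᵁ chart k l) {m : ℕ} {Θ : MvPolynomial τ Γ(Q, U)}
    (hΘ : Θ.IsHomogeneous m) :
    evalForm a b U j P h₁ h₂ Θ = ((b.appLE (chart k j) P h₂).hom (ratio k l j)) ^ m *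
      evalForm a b U l P h₁ h₂' Θ :=
  eval₂Hom_of_isHomogeneous _ _ _ _ (fun i ↦ appLE_ratio b j l h₂ i h₂') hΘ

variable {s : Q ⟶ Spec (.of k)}

lemma preChart_le_fst (f : T ⟶ RelProj s τ) (U : Q.Opens) :
    preChart f U j ≤ (f ≫ pullback.fst _ _) ⁻¹ᵁ U := inf_le_left

lemma preChart_le_snd (f : T ⟶ RelProj s τ) (U : Q.Opens) :
    preChart f U j ≤ (f ≫ pullback.snd _ _) ⁻¹ᵁ chart k j := inf_le_right

lemma pullbackForm_eq_evalForm (f : T ⟶ RelProj s τ) (U : Q.Opens) (Θ : MvPolynomial τ Γ(Q, U)) :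
    pullbackForm f U j Θ = evalForm (f ≫ pullback.fst _ _) (f ≫ pullback.snd _ _) U j
      (preChart f U j) (preChart_le_fst j f U) (preChart_le_snd j f U) Θ := rfl

lemma vanishesOn_iff (f : T ⟶ RelProj s τ) (U : Q.Opens) {Θ : MvPolynomial τ Γ(Q, U)} :
    VanishesOn f U Θ ↔ ∀ (j : τ) (P : T.Opens) (h₁ : P ≤ (f ≫ pullback.fst _ _) ⁻¹ᵁ U)
      (h₂ : P ≤ (f ≫ pullback.snd _ _) ⁻¹ᵁ chart k j), evalForm _ _ U j P h₁ h₂ Θ = 0 := by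
  constructor
  · intro h j P h₁ h₂
    rw [← evalForm_res _ _ _ (preChart_le_fst j f U) (preChart_le_snd j f U) (le_inf h₁ h₂),
      ← pullbackForm_eq_evalForm, h j, map_zero]
  · exact fun h j ↦ h j _ _ _

/-- It suffices to check the vanishing of a form on opens covering `T`, each with respect to one of
the standard charts. -/
lemma vanishesOn_of_locally (f : T ⟶ RelProj s τ) (U : Q.Opens) {m : ℕ}
    {Θ : MvPolynomial τ Γ(Q, U)} (hΘ : Θ.IsHomogeneous m)
    (H : ∀ t ∈ (f ≫ pullback.fst _ _) ⁻¹ᵁ U, ∃ (l : τ) (P : T.Opens)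
      (h₁ : P ≤ (f ≫ pullback.fst _ _) ⁻¹ᵁ U) (h₂ : P ≤ (f ≫ pullback.snd _ _) ⁻¹ᵁ chart k l),
      t ∈ P ∧ evalForm _ _ U l P h₁ h₂ Θ = 0) :
    VanishesOn f U Θ := by
  intro j
  refine T.IsSheaf.section_ext fun t ht ↦ ?_
  obtain ⟨l, P, h₁, h₂, htP, hP⟩ := H t ht.1
  refine ⟨preChart f U j ⊓ P, inf_le_left, ⟨ht, htP⟩, ?_⟩
  rw [map_zero, pullbackForm_eq_evalForm]
  refine (evalForm_res _ _ _ _ _ _ _).trans ?_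
  rw [evalForm_chart _ _ _ l _ _ (inf_le_right.trans h₂) hΘ,
    ← evalForm_res _ _ _ h₁ h₂ inf_le_right, hP, map_zero, mul_zero]

end EvalForm

/-! ### Forms vanishing on the linear span -/

section LinearSpan

variable {k : Type u} [Field k] {τ : Type} {T Q : Scheme.{u}} {s : Q ⟶ Spec (.of k)}

lemma vanishesOn_of_mem_homogeneousIdeal (f : T ⟶ RelProj s τ) (U : Q.affineOpens)
    {Θ : MvPolynomial τ Γ(Q, U)} (hΘ : Θ ∈ homogeneousIdeal f U) : VanishesOn f U Θ := by
  intro j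
  have : homogeneousIdeal f U ≤ RingHom.ker (evalForm (f ≫ pullback.fst _ _)
      (f ≫ pullback.snd _ _) U j (preChart f U j) (preChart_le_fst j f U)
      (preChart_le_snd j f U)) :=
    Ideal.span_le.mpr fun Θ hΘ ↦ hΘ.2 j
  exact this hΘ

lemma vanishesOn_map_coeff (f : T ⟶ RelProj s τ) {U U' : Q.Opens} (h : U' ≤ U)
    {Θ : MvPolynomial τ Γ(Q, U)} (hΘ : VanishesOn f U Θ) :
    VanishesOn f U' (MvPolynomial.map (Q.presheaf.map (homOfLE h).op).hom Θ) := by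
  rw [vanishesOn_iff] at hΘ ⊢
  intro j P h₁ h₂
  rw [evalForm_map_coeff _ _ _ (fun x hx ↦ h (h₁ hx))]
  exact hΘ j P _ _

lemma exists_isHomogeneous_map_eq {A B : Type*} [CommRing A] [CommRing B] [Algebra A B] (c : A)
    [IsLocalization.Away c B] {m : ℕ} {Θ : MvPolynomial τ B} (hΘ : Θ.IsHomogeneous m) :
    ∃ (N : ℕ) (Θ' : MvPolynomial τ A), Θ'.IsHomogeneous m ∧
      MvPolynomial.map (algebraMap A B) Θ' = MvPolynomial.C (algebraMap A B c ^ N) * Θ := by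
  let : Algebra (MvPolynomial τ A) (MvPolynomial τ B) := MvPolynomial.algebraMvPolynomial
  obtain ⟨⟨Θ', ⟨_, _, ⟨N, rfl⟩, rfl⟩⟩, h⟩ := IsLocalization.surj
    ((Submonoid.powers c).map (MvPolynomial.C (σ := τ))) Θ
  have h' : MvPolynomial.map (algebraMap A B) Θ' =
      MvPolynomial.C (algebraMap A B c ^ N) * Θ := by
    rw [← map_pow]
    refine h.symm.trans ?_
    rw [mul_comm]
    congr 1
    exact MvPolynomial.map_C _ _
  refine ⟨N, MvPolynomial.homogeneousComponent m Θ',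
    MvPolynomial.homogeneousComponent_isHomogeneous _ _, ?_⟩
  conv_rhs => rw [← MvPolynomial.homogeneousComponent_eq_self hΘ,
    ← MvPolynomial.homogeneousComponent_C_mul, ← h']
  ext b
  simp only [MvPolynomial.coeff_map, MvPolynomial.coeff_homogeneousComponent]
  split_ifs <;> simp

lemma evalForm_C (a : T ⟶ Q) (b : T ⟶ ProjSpace k τ) {U : Q.Opens} (j : τ) {P : T.Opens}
    (h₁ : P ≤ a ⁻¹ᵁ U) (h₂ : P ≤ b ⁻¹ᵁ chart k j) (c : Γ(Q, U)) :
    evalForm a b U j P h₁ h₂ (MvPolynomial.C c) = (a.appLE U P h₁).hom c :=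
  MvPolynomial.eval₂Hom_C _ _ _

/-- Quasi-coherence of the ideal of forms vanishing on `T`: a form with coefficients in
`𝒪_Q(D(h))` that vanishes on `T` extends to a form over `U` vanishing on `T`, up to a power of
`h`. -/
lemma exists_vanishesOn_extension [Finite τ] (f : T ⟶ RelProj s τ) (U : Q.affineOpens)
    (hc : ∀ j, IsCompact (preChart f U j : Set T)) (h : Γ(Q, U)) {m : ℕ}
    {Θ : MvPolynomial τ Γ(Q, Q.basicOpen h)} (hΘ : Θ.IsHomogeneous m)
    (hv : VanishesOn f (Q.basicOpen h) Θ) :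
    ∃ (N : ℕ) (Θ' : MvPolynomial τ Γ(Q, U)), Θ'.IsHomogeneous m ∧ VanishesOn f U Θ' ∧
      MvPolynomial.map (Q.presheaf.map (homOfLE (Q.basicOpen_le h)).op).hom Θ' =
        MvPolynomial.C ((Q.presheaf.map (homOfLE (Q.basicOpen_le h)).op).hom h ^ N) * Θ := by
  have hloc := U.2.isLocalization_basicOpen h
  obtain ⟨N, Θ₀, hΘ₀, e⟩ := exists_isHomogeneous_map_eq h hΘ
  rw [RingHom.algebraMap_toAlgebra] at e
  rw [vanishesOn_iff] at hv
  have key (j : τ) : ∃ n : ℕ, ((f ≫ pullback.fst _ _).appLE U (preChart f U j)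
      (preChart_le_fst j f U)).hom h ^ n * pullbackForm f U j Θ₀ = 0 := by
    refine exists_pow_mul_eq_zero_of_res_basicOpen_eq_zero_of_isCompact T (hc j) _ _ ?_
    have hle : T.basicOpen (((f ≫ pullback.fst _ _).appLE U (preChart f U j)
        (preChart_le_fst j f U)).hom h) ≤ (f ≫ pullback.fst _ _) ⁻¹ᵁ Q.basicOpen h := by
      exact (Scheme.basicOpen_appLE _ _ _ _ _).trans_le inf_le_right
    refine (evalForm_res (f ≫ pullback.fst _ _) (f ≫ pullback.snd _ _) j
      (preChart_le_fst j f U) (preChart_le_snd j f U) (T.basicOpen_le _) Θ₀).trans ?_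
    rw [← evalForm_map_coeff _ _ _ _ _ (Q.basicOpen_le h) hle, e, map_mul, hv, mul_zero]
  choose n hn using key
  cases nonempty_fintype τ
  refine ⟨Finset.univ.sup n + N, MvPolynomial.C (h ^ Finset.univ.sup n) * Θ₀, ?_, fun j ↦ ?_, ?_⟩
  · simpa using (MvPolynomial.isHomogeneous_C τ (h ^ Finset.univ.sup n)).mul hΘ₀
  · obtain ⟨r, hr⟩ := Nat.exists_eq_add_of_le' (Finset.le_sup (f := n) (Finset.mem_univ j))
    rw [hr, pullbackForm_eq_evalForm, map_mul, evalForm_C, map_pow, pow_add, mul_assoc,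
      ← pullbackForm_eq_evalForm, hn j, mul_zero]
  · rw [map_mul, e, MvPolynomial.map_C, ← mul_assoc, ← MvPolynomial.C_mul, pow_add, map_pow]

/-- The part of `ℙ_Q W` over `U` and over the chart `D₊(x_j)`. -/
abbrev relChart (s : Q ⟶ Spec (.of k)) (U : Q.Opens) (j : τ) : (RelProj s τ).Opens :=
  pullback.fst s (ProjSpace.toSpec k τ) ⁻¹ᵁ U ⊓ pullback.snd s (ProjSpace.toSpec k τ) ⁻¹ᵁ chart k j

/-- The function `Θ / x_j ^ m` on the part of `ℙ_Q W` over `U` and over the chart `D₊(x_j)`. -/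
abbrev relForm (s : Q ⟶ Spec (.of k)) (U : Q.Opens) (j : τ) (Θ : MvPolynomial τ Γ(Q, U)) :
    Γ(RelProj s τ, relChart s U j) :=
  evalForm (pullback.fst _ _) (pullback.snd _ _) U j (relChart s U j) inf_le_left inf_le_right Θ

lemma app_relForm (f : T ⟶ RelProj s τ) (U : Q.Opens) (j : τ) (Θ : MvPolynomial τ Γ(Q, U)) :
    (f.app (relChart s U j)).hom (relForm s U j Θ) = pullbackForm f U j Θ := by
  rw [pullbackForm_eq_evalForm, Scheme.Hom.app_eq_appLE]
  exact appLE_evalForm _ _ _ _ _ f le_rfl _ _ Θ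

lemma app_relForm_eq_zero (f : T ⟶ RelProj s τ) (U : Q.Opens) (j : τ)
    (Θ : MvPolynomial τ Γ(Q, U)) :
    (f.app (relChart s U j)).hom (relForm s U j Θ) = 0 ↔ pullbackForm f U j Θ = 0 := by
  rw [← app_relForm]
  rfl

lemma iSup_relChart (s : Q ⟶ Spec (.of k)) :
    ⨆ i : Q.affineOpens × τ, relChart s i.1.1 i.2 = ⊤ := by
  refine top_le_iff.mp fun p _ ↦ ?_
  obtain ⟨U, hU, -⟩ := exists_affineOpens_mem_le (U := ⊤)
    (p := (pullback.fst s (ProjSpace.toSpec k τ)) p) trivial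
  obtain ⟨j, hj⟩ := TopologicalSpace.Opens.mem_iSup.mp
    ((Proj.iSup_basicOpen_eq_top (grading k τ) MvPolynomial.X (irrelevant_le_span_X k)).ge
      (Set.mem_univ ((pullback.snd s (ProjSpace.toSpec k τ)) p)))
  exact TopologicalSpace.Opens.mem_iSup.mpr ⟨(U, j), hU, hj⟩

lemma germ_evalForm {U : Q.Opens} {j : τ} {P : (RelProj s τ).Opens} (h : P ≤ relChart s U j)
    {p : (RelProj s τ : Scheme.{u})} (hp : p ∈ P) (Θ : MvPolynomial τ Γ(Q, U)) :
    (RelProj s τ).presheaf.germ P p hp (evalForm (pullback.fst _ _) (pullback.snd _ _) U j P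
      (h.trans inf_le_left) (h.trans inf_le_right) Θ) =
      (RelProj s τ).presheaf.germ (relChart s U j) p (h hp) (relForm s U j Θ) := by
  rw [← evalForm_res _ _ _ (P := relChart s U j) inf_le_left inf_le_right h]
  exact (RelProj s τ).presheaf.germ_res_apply (homOfLE h) p hp _

/-- If an ideal of the stalk at `p` contains the germs of all forms of degree `m` over `U'` that
vanish on `T`, then also of those over any other affine open `U`. -/
lemma germ_relForm_mem [Finite τ] (f : T ⟶ RelProj s τ) (U U' : Q.affineOpens) (j j' : τ)
    (hc : ∀ j, IsCompact (preChart f U' j : Set T))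
    {p : (RelProj s τ : Scheme.{u})} (hi : p ∈ relChart s U.1 j) (hj : p ∈ relChart s U'.1 j')
    {m : ℕ} {Θ : MvPolynomial τ Γ(Q, U)} (hΘm : Θ.IsHomogeneous m) (hΘv : VanishesOn f U Θ)
    (I : Ideal ((RelProj s τ).presheaf.stalk p))
    (hI : ∀ Θ' : MvPolynomial τ Γ(Q, U'), Θ'.IsHomogeneous m → VanishesOn f U' Θ' →
      (RelProj s τ).presheaf.germ (relChart s U'.1 j') p hj (relForm s U'.1 j' Θ') ∈ I) :
    (RelProj s τ).presheaf.germ (relChart s U.1 j) p hi (relForm s U.1 j Θ) ∈ I := by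
  obtain ⟨h, hhU, hp⟩ := U'.2.exists_basicOpen_le (V := U.1) ⟨_, hi.1⟩ hj.1
  obtain ⟨N, Θ', hΘ'm, hΘ'v, e⟩ := exists_vanishesOn_extension f U' hc h
    (hΘm.map _) (vanishesOn_map_coeff f hhU hΘv)
  let P : (RelProj s τ).Opens := relChart s U j ⊓ relChart s U' j' ⊓
    pullback.fst s (ProjSpace.toSpec k τ) ⁻¹ᵁ Q.basicOpen h
  have hP : p ∈ P := ⟨⟨hi, hj⟩, hp⟩
  have hPj : P ≤ relChart s U j := inf_le_left.trans inf_le_left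
  have hPj' : P ≤ relChart s U' j' := inf_le_left.trans inf_le_right
  have h1 := congr(evalForm (pullback.fst _ _) (pullback.snd _ _) (Q.basicOpen h) j P inf_le_right
    (hPj.trans inf_le_right) $e)
  rw [evalForm_map_coeff _ _ _ (hPj'.trans inf_le_left), map_mul, evalForm_C,
    evalForm_map_coeff _ _ _ (hPj.trans inf_le_left),
    evalForm_chart _ _ _ j' _ _ (hPj'.trans inf_le_right) hΘ'm] at h1
  have hu : IsUnit (((pullback.fst s (ProjSpace.toSpec k τ)).appLE _ P inf_le_right).hom
      ((Q.presheaf.map (homOfLE (Q.basicOpen_le h)).op).hom h ^ N)) :=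
    ((RingedSpace.isUnit_res_basicOpen _ h).pow N).map _
  have h2 := congr((RelProj s τ).presheaf.germ P p hP $h1)
  rw [map_mul, map_mul, germ_evalForm hPj hP, germ_evalForm hPj' hP] at h2
  refine (Ideal.unit_mul_mem_iff_mem _
    (hu.map ((RelProj s τ).presheaf.germ P p hP).hom)).mp ?_
  exact h2 ▸ Ideal.mul_mem_left I _ (hI Θ' hΘ'm hΘ'v)

/-- The functions on `relChart s U j` given by the homogeneous elements of `J U`. -/
def relForms (s : Q ⟶ Spec (.of k)) (J : ∀ U : Q.affineOpens, Ideal (MvPolynomial τ Γ(Q, U)))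
    (i : Q.affineOpens × τ) : Set Γ(RelProj s τ, relChart s i.1.1 i.2) :=
  {g | ∃ Θ ∈ J i.1, (∃ m, Θ.IsHomogeneous m) ∧ relForm s i.1.1 i.2 Θ = g}

lemma stalkCompatible_linearIdeal [Finite τ] (f : T ⟶ RelProj s τ)
    (hc : ∀ (U : Q.affineOpens) (j : τ), IsCompact (preChart f U j : Set T)) :
    StalkCompatible (fun i : Q.affineOpens × τ ↦ relChart s i.1.1 i.2)
      (relForms s (linearIdeal f)) := by
  intro i i' p hi hj
  refine Ideal.span_le.mpr ?_
  rintro _ ⟨_, ⟨Θ, hΘ, -, rfl⟩, rfl⟩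
  have key : linearIdeal f i.1 ≤ (stalkSpan (fun i : Q.affineOpens × τ ↦ relChart s i.1.1 i.2)
      (relForms s (linearIdeal f)) i' p hj).comap
      (((RelProj s τ).presheaf.germ _ p hi).hom.comp (evalForm (pullback.fst _ _)
        (pullback.snd _ _) i.1.1 i.2 (relChart s i.1.1 i.2) inf_le_left inf_le_right)) := by
    refine Ideal.span_le.mpr ?_
    rintro Θ ⟨hΘ, m, hm, hΘm⟩
    rw [SetLike.mem_coe, Ideal.mem_comap]
    refine germ_relForm_mem f i.1 i'.1 i.2 i'.2 (hc _) hi hj hΘm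
      (vanishesOn_of_mem_homogeneousIdeal f _ hΘ) _ fun Θ' hΘ'm hΘ'v ↦ ?_
    exact Ideal.subset_span ⟨_, ⟨Θ', Ideal.subset_span
      ⟨Ideal.subset_span ⟨⟨m, hΘ'm⟩, hΘ'v⟩, m, hm, hΘ'm⟩, ⟨m, hΘ'm⟩, rfl⟩, rfl⟩
  exact key hΘ

lemma vanishingIdealSheaf_eq (J : ∀ U : Q.affineOpens, Ideal (MvPolynomial τ Γ(Q, U))) :
    vanishingIdealSheaf (s := s) J = sInf {K | ∀ i, ∀ g ∈ relForms s J i,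
      (K.subschemeι.app (relChart s i.1.1 i.2)).hom g = 0} := by
  rw [vanishingIdealSheaf]
  congr 1
  ext K
  constructor
  · rintro hK ⟨U, j⟩ _ ⟨Θ, hΘ, hm, rfl⟩
    exact (app_relForm_eq_zero _ _ _ _).mpr (hK U Θ hΘ hm j)
  · intro hK U Θ hΘ hm j
    exact (app_relForm_eq_zero _ _ _ _).mp (hK ⟨U, j⟩ _ ⟨Θ, hΘ, hm, rfl⟩)

/-- The forms defining the linear span vanish on it. -/
theorem vanishesOn_linearSpanι [Finite τ] (f : T ⟶ RelProj s τ)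
    (hc : ∀ (U : Q.affineOpens) (j : τ), IsCompact (preChart f U j : Set T)) (U : Q.affineOpens)
    {Θ : MvPolynomial τ Γ(Q, U)} (hΘ : Θ ∈ linearIdeal f U) {m : ℕ} (hm : Θ.IsHomogeneous m) :
    VanishesOn (linearSpanι f) U Θ := by
  intro j
  have h := subschemeι_sInf_app_eq_zero (stalkCompatible_linearIdeal f hc) (iSup_relChart s)
    (i := (U, j)) (g := relForm s U.1 j Θ) ⟨Θ, hΘ, ⟨m, hm⟩, rfl⟩
  rw [← vanishingIdealSheaf_eq] at h
  exact (app_relForm_eq_zero _ _ _ _).mp h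

end LinearSpan

/-! ### Finiteness of projective space, sections of the standard charts, and the Veronese map -/

section Finiteness

variable (k : Type u) [Field k] (σ : Type)

instance [Finite σ] : Algebra.FiniteType (grading k σ 0) (MvPolynomial σ k) :=
  have : IsScalarTower k (grading k σ 0) (MvPolynomial σ k) :=
    IsScalarTower.of_algebraMap_eq (R := k) (S := grading k σ 0) (A := MvPolynomial σ k) fun _ ↦ rfl
  .of_restrictScalars_finiteType k _ _

lemma algebraMap_grading_zero_surjective :
    Function.Surjective (algebraMap k (grading k σ 0)) := by
  rintro ⟨p, hp⟩
  refine ⟨p.coeff 0, Subtype.ext ?_⟩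
  have h := MvPolynomial.totalDegree_eq_zero_iff_eq_C.mp
    ((MvPolynomial.totalDegree_zero_iff_isHomogeneous _).mpr hp)
  exact h.symm

instance [Finite σ] : LocallyOfFiniteType (ProjSpace.toSpec k σ) := by
  have : LocallyOfFiniteType (Spec.map (CommRingCat.ofHom (algebraMap k (grading k σ 0)))) :=
    (HasRingHomProperty.Spec_iff (P := @LocallyOfFiniteType)).mpr
      (RingHom.FiniteType.of_surjective _ (algebraMap_grading_zero_surjective k σ))
  exact inferInstanceAs (LocallyOfFiniteType (Proj.toSpecZero (grading k σ) ≫ Spec.map _))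

instance [Finite σ] : QuasiCompact (ProjSpace.toSpec k σ) :=
  inferInstanceAs (QuasiCompact (Proj.toSpecZero (grading k σ) ≫ Spec.map _))

instance (τ : Type) : IsSeparated (ProjSpace.toSpec k τ) :=
  inferInstanceAs (IsSeparated (Proj.toSpecZero (grading k τ) ≫ Spec.map _))

variable {k σ} {Q : Scheme.{u}} (s : Q ⟶ Spec (.of k))

/-- If `Q` is locally Noetherian, then so is `ℙ_Q V`, and subsets of a subscheme of `ℙ_Q V` lying
over an affine open of `Q` are compact. -/
lemma isCompact_of_le_preimage [Finite σ] [IsLocallyNoetherian Q] {R : Scheme.{u}}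
    (i : R ⟶ RelProj s σ) [IsImmersion i] (U : Q.affineOpens) {A : Set R}
    (hA : A ⊆ (i ≫ pullback.fst _ _) ⁻¹ᵁ U.1) : IsCompact A := by
  let C : (RelProj s σ).Opens := pullback.fst s (ProjSpace.toSpec k σ) ⁻¹ᵁ U.1
  have hC : IsCompact (C : Set (RelProj s σ : Scheme.{u})) :=
    QuasiCompact.isCompact_preimage (f := pullback.fst s (ProjSpace.toSpec k σ)) _ U.1.2
      U.2.isCompact
  have : CompactSpace C := isCompact_iff_compactSpace.mp hC
  have : IsNoetherian C.toScheme := { }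
  have hN : TopologicalSpace.NoetherianSpace C := inferInstanceAs
    (TopologicalSpace.NoetherianSpace C.toScheme)
  rw [i.isEmbedding.isInducing.isCompact_iff]
  refine (TopologicalSpace.noetherianSpace_set_iff _).mp hN _ ?_
  rintro _ ⟨x, hx, rfl⟩
  exact hA hx

end Finiteness

section AwaySections

variable {k : Type u} [Field k] {τ : Type}

lemma le_preimage_top {X Y : Scheme.{u}} (β : X ⟶ Y) (P : X.Opens) : P ≤ β ⁻¹ᵁ ⊤ := le_top

lemma isIso_appTop {X Y : Scheme.{u}} (β : X ⟶ Y) (_ : IsIso β) : IsIso β.appTop :=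
  inferInstanceAs (IsIso (β.app ⊤))

lemma awayToSection_awayι (f : MvPolynomial τ k) {m : ℕ} (hf : f ∈ grading k τ m) (hm : 0 < m) :
    Proj.awayToSection (grading k τ) f ≫ (Proj.awayι (grading k τ) f hf hm).appLE
      (Proj.basicOpen (grading k τ) f) ⊤ (by
        rw [← Proj.opensRange_awayι (grading k τ) f hf hm, Scheme.Hom.preimage_opensRange]) =
      (Scheme.ΓSpecIso _).inv := by
  have h := Proj.basicOpenToSpec_app_top (grading k τ) f
  rw [← Proj.basicOpenIsoSpec_hom (grading k τ) f hf hm] at h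
  have h' : Proj.awayToSection (grading k τ) f ≫ (Proj.basicOpen (grading k τ) f).topIso.inv =
      (Scheme.ΓSpecIso _).inv ≫ (Proj.basicOpenIsoSpec (grading k τ) f hf hm).hom.appTop := by
    rw [Iso.eq_inv_comp]
    exact h.symm
  have e : (Proj.basicOpen (grading k τ) f).ι =
      (Proj.basicOpenIsoSpec (grading k τ) f hf hm).hom ≫ Proj.awayι (grading k τ) f hf hm := by
    rw [Proj.awayι, Iso.hom_inv_id_assoc]
  have hmono : Mono (Proj.basicOpenIsoSpec (grading k τ) f hf hm).hom.appTop :=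
    have := isIso_appTop _ (Iso.isIso_hom (Proj.basicOpenIsoSpec (grading k τ) f hf hm))
    IsIso.mono_of_iso _
  rw [← cancel_mono (Proj.basicOpenIsoSpec (grading k τ) f hf hm).hom.appTop, ← h', Category.assoc]
  congr 1
  change _ ≫ Scheme.Hom.app _ ⊤ = _
  rw [Scheme.Hom.app_eq_appLE, Scheme.Hom.appLE_comp_appLE]
  have e2 := Scheme.Opens.ι_appLE (U := Proj.basicOpen (grading k τ) f)
    (Proj.basicOpen (grading k τ) f) ⊤ (by simp)
  simp only [← e]
  exact e2

/-- On a morphism that factors through `Spec k[x]_(f)`, sections of `D₊(f)` pull back like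
elements of `k[x]_(f)`. -/
lemma appLE_awayToSection {X : Scheme.{u}} (f : MvPolynomial τ k) {m : ℕ} (hf : f ∈ grading k τ m)
    (hm : 0 < m) (β : X ⟶ Spec (.of (HomogeneousLocalization.Away (grading k τ) f)))
    (G : X ⟶ ProjSpace k τ) (hG : β ≫ Proj.awayι (grading k τ) f hf hm = G) (P : X.Opens)
    (hP : P ≤ G ⁻¹ᵁ Proj.basicOpen (grading k τ) f)
    (z : HomogeneousLocalization.Away (grading k τ) f) :
    (G.appLE _ P hP).hom ((Proj.awayToSection (grading k τ) f).hom z) =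
      (β.appLE ⊤ P (le_preimage_top β P)).hom ((Scheme.ΓSpecIso _).inv.hom z) := by
  subst hG
  rw [← awayToSection_awayι f hf hm, ← CommRingCat.comp_apply, ← CommRingCat.comp_apply,
    Category.assoc, Scheme.Hom.appLE_comp_appLE]

end AwaySections

section Veronese

variable (k : Type u) [Field k] {σ : Type} (d : ℕ)

lemma chart_le_preimage_veronese (j : σ) :
    chart k j ≤ veronese k σ d ⁻¹ᵁ chart k (powIdx d j) := by
  intro x hx
  obtain ⟨y, rfl⟩ := (Proj.opensRange_awayι (grading k σ) _ (X_mem_grading k j) one_pos).ge hx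
  change veronese k σ d (Proj.awayι (grading k σ) _ (X_mem_grading k j) one_pos y) ∈
    chart k (powIdx d j)
  rw [← Scheme.Hom.comp_apply, awayι_veronese, verChart, Scheme.Hom.comp_apply]
  exact (Proj.opensRange_awayι (grading k (DegIdx σ d)) _ (X_mem_grading k (powIdx d j))
    one_pos).le ⟨_, rfl⟩

lemma awayEval_verEval_mk (j : σ) (a : DegIdx σ d) (h) :
    awayEval (verEval k d j) (MvPolynomial.X (powIdx d j)) h
      (HomogeneousLocalization.Away.mk (grading k (DegIdx σ d)) (X_mem_grading k (powIdx d j)) 1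
        (MvPolynomial.X a) (by simpa using X_mem_grading k a)) = verCoord k d j a := by
  have := awayEval_mk_mul (verEval k d j) (MvPolynomial.X (powIdx d j)) h
    (X_mem_grading k (powIdx d j)) 1 (MvPolynomial.X a) (by simpa using X_mem_grading k a)
  rw [verEval_powIdx, one_pow, mul_one] at this
  rw [this, verEval, MvPolynomial.eval₂Hom_X']

lemma awayToSection_verCoord (j : σ) (a : DegIdx σ d) :
    (Proj.awayToSection (grading k σ) (MvPolynomial.X j)).hom (verCoord k d j a) =
      a.1.prod fun i r ↦ ratio k i j ^ r := by
  simp only [ratio, Finsupp.prod, ← map_pow, ← map_prod]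
  congr 1
  apply HomogeneousLocalization.val_injective
  rw [verCoord, HomogeneousLocalization.Away.val_mk, ← HomogeneousLocalization.algebraMap_apply,
    map_prod]
  simp only [map_pow, HomogeneousLocalization.algebraMap_apply,
    HomogeneousLocalization.Away.val_mk, Localization.mk_pow, Localization.mk_prod]
  rw [Localization.mk_eq_mk_iff, Localization.r_iff_exists]
  refine ⟨1, ?_⟩
  have h : ∑ i ∈ a.1.support, a.1 i = d := a.2
  rw [MvPolynomial.monomial_eq, Finsupp.prod]
  simp [Finset.prod_pow_eq_pow_sum, h]

/-- In the chart `D₊(α_j)`, the Veronese map is `y_a / y_{d e_j} ↦ α ^ a / α_j ^ d`. -/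
lemma appLE_veronese_ratio (j : σ) (a : DegIdx σ d) :
    ((veronese k σ d).appLE (chart k (powIdx d j)) (chart k j)
      (chart_le_preimage_veronese k d j)).hom (ratio k a (powIdx d j)) =
      a.1.prod fun i r ↦ ratio k i j ^ r := by
  rw [← awayToSection_verCoord]
  have h : ⊤ ≤ Proj.awayι (grading k σ) (MvPolynomial.X j) (X_mem_grading k j) one_pos ⁻¹ᵁ
      chart k j := fun x _ ↦
    (Proj.opensRange_awayι (grading k σ) _ (X_mem_grading k j) one_pos).le ⟨x, rfl⟩
  have hiso : IsIso ((Proj.awayι (grading k σ) (MvPolynomial.X j) (X_mem_grading k j)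
      one_pos).appLE (chart k j) ⊤ h) := by
    have h1 := awayToSection_awayι _ (X_mem_grading k j) one_pos
    rw [← Proj.basicOpenIsoAway_hom (grading k σ) _ (X_mem_grading k j) one_pos,
      ← Iso.eq_inv_comp] at h1
    rw [h1]
    infer_instance
  apply (ConcreteCategory.bijective_of_isIso ((Proj.awayι (grading k σ) (MvPolynomial.X j)
    (X_mem_grading k j) one_pos).appLE (chart k j) ⊤ h)).1
  have h2 := appLE_awayToSection _ (X_mem_grading k j) one_pos (𝟙 _) _ (Category.id_comp _) ⊤ h
    (verCoord k d j a)
  refine Eq.trans ?_ h2.symm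
  rw [← CommRingCat.comp_apply, Scheme.Hom.appLE_comp_appLE]
  refine (appLE_awayToSection _ (X_mem_grading k (powIdx d j)) one_pos (Spec.map _) _
    (awayι_veronese k d j).symm ⊤ _ _).trans ?_
  rw [← awayEval_verEval_mk k d j a (by rw [verEval_powIdx]; exact isUnit_one)]
  have h3 := Scheme.ΓSpecIso_inv_naturality (CommRingCat.ofHom (awayEval (verEval k d j)
    (MvPolynomial.X (powIdx d j)) (by rw [verEval_powIdx]; exact isUnit_one)))
  have h4 := congr($(h3).hom (HomogeneousLocalization.Away.mk (grading k (DegIdx σ d))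
    (X_mem_grading k (powIdx d j)) 1 (MvPolynomial.X a) (by simpa using X_mem_grading k a)))
  exact h4.symm

end Veronese

/-! ### Pullback of forms along the Veronese map, and lifts to affine space -/

section VeroneseForms

/-- The substitution `y_a ↦ α ^ a`, i.e. the pullback of forms along the Veronese map. -/
def veroneseForm (A : Type*) [CommRing A] (σ : Type) (d : ℕ) :
    MvPolynomial (DegIdx σ d) A →ₐ[A] MvPolynomial σ A :=
  MvPolynomial.aeval fun a ↦ MvPolynomial.monomial a.1 1

lemma veroneseForm_X {A : Type*} [CommRing A] {σ : Type} {d : ℕ} (a : DegIdx σ d) :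
    veroneseForm A σ d (MvPolynomial.X a) = MvPolynomial.monomial a.1 1 :=
  MvPolynomial.aeval_X _ _

variable {k : Type u} [Field k] {σ : Type} {d : ℕ} {T Q : Scheme.{u}}

lemma le_preimage_veronese (b : T ⟶ ProjSpace k σ) (j : σ) {P : T.Opens}
    (h₂ : P ≤ b ⁻¹ᵁ chart k j) : P ≤ (b ≫ veronese k σ d) ⁻¹ᵁ chart k (powIdx d j) :=
  h₂.trans fun _ hx ↦ chart_le_preimage_veronese k d j hx

lemma evalForm_veronese (a : T ⟶ Q) (b : T ⟶ ProjSpace k σ) {U : Q.Opens} (j : σ) {P : T.Opens}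
    (h₁ : P ≤ a ⁻¹ᵁ U) (h₂ : P ≤ b ⁻¹ᵁ chart k j) (Θ : MvPolynomial (DegIdx σ d) Γ(Q, U)) :
    evalForm a (b ≫ veronese k σ d) U (powIdx d j) P h₁ (le_preimage_veronese b j h₂) Θ =
      evalForm a b U j P h₁ h₂ (veroneseForm _ σ d Θ) := by
  have e : evalForm a (b ≫ veronese k σ d) U (powIdx d j) P h₁ (le_preimage_veronese b j h₂) =
      (evalForm a b U j P h₁ h₂).comp (veroneseForm _ σ d).toRingHom := by
    refine MvPolynomial.ringHom_ext (fun c ↦ ?_) (fun m ↦ ?_)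
    · rw [evalForm_C]
      refine ((congrArg _ ?_).trans (evalForm_C a b j h₁ h₂ c)).symm
      exact MvPolynomial.aeval_C _ _
    · rw [RingHom.comp_apply]
      refine Eq.trans ?_ (congrArg _ (veroneseForm_X m)).symm
      simp only [evalForm, MvPolynomial.eval₂Hom_X', MvPolynomial.coe_eval₂Hom,
        MvPolynomial.eval₂_monomial, map_one, one_mul]
      have h := congr((b.appLE _ P h₂).hom $(appLE_veronese_ratio k d j m))
      rw [← CommRingCat.comp_apply, Scheme.Hom.appLE_comp_appLE] at h
      rw [h, Finsupp.prod, map_prod]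
      simp only [map_pow]
      rfl
  exact congr($e Θ)

variable {s : Q ⟶ Spec (.of k)}

lemma relVeronese_fst (i : T ⟶ RelProj s σ) :
    (i ≫ relVeronese s σ d) ≫ pullback.fst _ _ = i ≫ pullback.fst _ _ := by
  rw [Category.assoc, relVeronese, pullback.lift_fst]

lemma relVeronese_snd (i : T ⟶ RelProj s σ) :
    (i ≫ relVeronese s σ d) ≫ pullback.snd _ _ = (i ≫ pullback.snd _ _) ≫ veronese k σ d := by
  rw [Category.assoc, relVeronese, pullback.lift_snd, Category.assoc]

variable {τ : Type}

lemma vanishesOn_iff_of_eq (f : T ⟶ RelProj s τ) {a : T ⟶ Q} {b : T ⟶ ProjSpace k τ}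
    (ha : f ≫ pullback.fst _ _ = a) (hb : f ≫ pullback.snd _ _ = b) (U : Q.Opens)
    {Θ : MvPolynomial τ Γ(Q, U)} :
    VanishesOn f U Θ ↔ ∀ (j : τ) (P : T.Opens) (h₁ : P ≤ a ⁻¹ᵁ U) (h₂ : P ≤ b ⁻¹ᵁ chart k j),
      evalForm a b U j P h₁ h₂ Θ = 0 := by
  subst ha hb
  exact vanishesOn_iff f U

lemma vanishesOn_of_locally_of_eq (f : T ⟶ RelProj s τ) {a : T ⟶ Q} {b : T ⟶ ProjSpace k τ}
    (ha : f ≫ pullback.fst _ _ = a) (hb : f ≫ pullback.snd _ _ = b) (U : Q.Opens) {m : ℕ}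
    {Θ : MvPolynomial τ Γ(Q, U)} (hΘ : Θ.IsHomogeneous m)
    (H : ∀ t ∈ a ⁻¹ᵁ U, ∃ (l : τ) (P : T.Opens) (h₁ : P ≤ a ⁻¹ᵁ U) (h₂ : P ≤ b ⁻¹ᵁ chart k l),
      t ∈ P ∧ evalForm a b U l P h₁ h₂ Θ = 0) : VanishesOn f U Θ := by
  subst ha hb
  exact vanishesOn_of_locally f U hΘ H

lemma exists_mem_preimage_chart (b : T ⟶ ProjSpace k τ) (t : T) :
    ∃ j : τ, t ∈ b ⁻¹ᵁ chart k j := by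
  have h : b t ∈ ⨆ j : τ, chart k j :=
    (Proj.iSup_basicOpen_eq_top (grading k τ) MvPolynomial.X (irrelevant_le_span_X k)).ge
      (Set.mem_univ (b t))
  obtain ⟨j, hj⟩ := TopologicalSpace.Opens.mem_iSup.mp h
  exact ⟨j, hj⟩

lemma vanishesOn_veroneseForm (i : T ⟶ RelProj s σ) (U : Q.Opens)
    {Θ : MvPolynomial (DegIdx σ d) Γ(Q, U)} (h : VanishesOn (i ≫ relVeronese s σ d) U Θ) :
    VanishesOn i U (veroneseForm _ σ d Θ) := by
  rw [vanishesOn_iff_of_eq _ (relVeronese_fst i) (relVeronese_snd i)] at h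
  rw [vanishesOn_iff]
  intro j P h₁ h₂
  rw [← evalForm_veronese]
  exact h _ _ _ _

lemma vanishesOn_relVeronese (i : T ⟶ RelProj s σ) (U : Q.Opens) {m : ℕ}
    {Θ : MvPolynomial (DegIdx σ d) Γ(Q, U)} (hm : Θ.IsHomogeneous m)
    (h : VanishesOn i U (veroneseForm _ σ d Θ)) :
    VanishesOn (i ≫ relVeronese s σ d) U Θ := by
  refine vanishesOn_of_locally_of_eq _ (relVeronese_fst i) (relVeronese_snd i) U hm fun t ht ↦ ?_
  obtain ⟨j, hj⟩ := exists_mem_preimage_chart (i ≫ pullback.snd _ _) t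
  refine ⟨powIdx d j, preChart i U j, preChart_le_fst j i U,
    le_preimage_veronese _ j (preChart_le_snd j i U), ⟨ht, hj⟩, ?_⟩
  rw [evalForm_veronese]
  exact h j

end VeroneseForms

section Lifts

variable {k : Type u} [Field k] {τ : Type} {X : Scheme.{u}}

/-- The element `x_i / x_j` of `k[x]_(x_j)`. -/
abbrev awayRatio (k : Type u) [Field k] {τ : Type} (i j : τ) :
    HomogeneousLocalization.Away (grading k τ) (MvPolynomial.X j) :=
  HomogeneousLocalization.Away.mk (grading k τ) (X_mem_grading k j) 1 (MvPolynomial.X i)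
    (by simpa using X_mem_grading k i)

/-- The ring map `k[x] → k[x]_(x_j)`, `x_i ↦ x_i / x_j`. -/
def dehomogenize (k : Type u) [Field k] {τ : Type} (j : τ) : MvPolynomial τ k →+*
    HomogeneousLocalization.Away (grading k τ) (MvPolynomial.X j) :=
  MvPolynomial.eval₂Hom
    ((HomogeneousLocalization.fromZeroRingHom (grading k τ) _).comp (algebraMap k (grading k τ 0)))
    (fun i ↦ awayRatio k i j)

lemma val_awayRatio (i j : τ) :
    algebraMap (MvPolynomial τ k) (Localization.Away (MvPolynomial.X j)) (MvPolynomial.X j) *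
      (awayRatio k i j).val =
        algebraMap (MvPolynomial τ k) (Localization.Away (MvPolynomial.X j))
          (MvPolynomial.X i) := by
  rw [HomogeneousLocalization.Away.val_mk, ← Localization.mk_one_eq_algebraMap,
    ← Localization.mk_one_eq_algebraMap, Localization.mk_mul, Localization.mk_eq_mk_iff,
    Localization.r_iff_exists]
  exact ⟨1, by simp⟩

lemma dehomogenize_surjective (j : τ) : Function.Surjective (dehomogenize k j) := by
  intro z
  obtain ⟨r, p, hp, rfl⟩ :=
    HomogeneousLocalization.Away.mk_surjective (grading k τ) (X_mem_grading k j) z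
  refine ⟨p, HomogeneousLocalization.val_injective _ ?_⟩
  have hr : p.IsHomogeneous r := by simpa using hp
  have h1 := eval₂Hom_of_isHomogeneous
    ((algebraMap (MvPolynomial τ k) (Localization.Away (MvPolynomial.X j))).comp MvPolynomial.C)
    (fun i ↦ algebraMap _ _ (MvPolynomial.X i)) (fun i ↦ (awayRatio k i j).val) _
    (fun i ↦ (val_awayRatio i j).symm) hr
  have h2 : MvPolynomial.eval₂Hom
      ((algebraMap (MvPolynomial τ k) (Localization.Away (MvPolynomial.X j))).comp MvPolynomial.C)
      (fun i ↦ algebraMap (MvPolynomial τ k)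
        (Localization.Away (MvPolynomial.X j : MvPolynomial τ k)) (MvPolynomial.X i)) =
        algebraMap (MvPolynomial τ k) (Localization.Away (MvPolynomial.X j)) :=
    MvPolynomial.ringHom_ext (fun c ↦ MvPolynomial.eval₂Hom_C _ _ _)
      (fun i ↦ MvPolynomial.eval₂Hom_X' _ _ _)
  have h3 : MvPolynomial.eval₂Hom
      ((algebraMap (MvPolynomial τ k) (Localization.Away (MvPolynomial.X j))).comp MvPolynomial.C)
      (fun i ↦ (awayRatio k i j).val) =
        (algebraMap (HomogeneousLocalization.Away (grading k τ) (MvPolynomial.X j))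
          (Localization.Away (MvPolynomial.X j))).comp (dehomogenize k j) := by
    refine MvPolynomial.ringHom_ext (fun c ↦ ?_) (fun i ↦ ?_)
    · simp only [dehomogenize, MvPolynomial.eval₂Hom_C, RingHom.comp_apply]
      exact (Localization.mk_one_eq_algebraMap _).symm
    · simp only [dehomogenize, MvPolynomial.eval₂Hom_X', RingHom.comp_apply]
      rfl
  rw [h2, h3, RingHom.comp_apply] at h1
  have hu : IsUnit (algebraMap (MvPolynomial τ k) (Localization.Away (MvPolynomial.X j))
    (MvPolynomial.X j)) :=
    IsLocalization.Away.algebraMap_isUnit (R := MvPolynomial τ k)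
      (S := Localization.Away (MvPolynomial.X j : MvPolynomial τ k)) (MvPolynomial.X j)
  apply (hu.pow r).mul_right_inj.mp
  refine h1.symm.trans ?_
  rw [HomogeneousLocalization.Away.val_mk, ← map_pow, ← Localization.mk_one_eq_algebraMap,
    ← Localization.mk_one_eq_algebraMap, Localization.mk_mul, Localization.mk_eq_mk_iff,
    Localization.r_iff_exists]
  exact ⟨1, by simp⟩

lemma appLE_top_top {Y : Scheme.{u}} (f : X ⟶ Y) (h : ⊤ ≤ f ⁻¹ᵁ ⊤) :
    f.appLE ⊤ ⊤ h = f.appTop :=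
  (Scheme.Hom.app_eq_appLE f).symm

/-- A morphism to `Spec R` is determined by the corresponding map `R → Γ(X, 𝒪_X)`. -/
lemma hom_spec_ext {R : CommRingCat.{u}} {f g : X ⟶ Spec R}
    (h : (Scheme.ΓSpecIso R).inv ≫ f.appTop = (Scheme.ΓSpecIso R).inv ≫ g.appTop) : f = g :=
  ext_of_isAffine ((cancel_epi _).mp h)

/-- A morphism to the chart `D₊(x_j)` is determined by its structure morphism and the pullbacks of
the functions `x_i / x_j`. -/
lemma hom_ext_of_ratio {G₁ G₂ : X ⟶ ProjSpace k τ} (j : τ) (h₁ : ⊤ ≤ G₁ ⁻¹ᵁ chart k j)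
    (h₂ : ⊤ ≤ G₂ ⁻¹ᵁ chart k j)
    (h : G₁ ≫ ProjSpace.toSpec k τ = G₂ ≫ ProjSpace.toSpec k τ)
    (H : ∀ i, (G₁.appLE _ ⊤ h₁).hom (ratio k i j) = (G₂.appLE _ ⊤ h₂).hom (ratio k i j)) :
    G₁ = G₂ := by
  have hfac (G : X ⟶ ProjSpace k τ) (hG : ⊤ ≤ G ⁻¹ᵁ chart k j) :
      ∃ β, β ≫ Proj.awayι (grading k τ) (MvPolynomial.X j) (X_mem_grading k j) one_pos = G := by
    refine ⟨IsOpenImmersion.lift (Proj.awayι (grading k τ) (MvPolynomial.X j) (X_mem_grading k j)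
      one_pos) G ?_, IsOpenImmersion.lift_fac _ _ _⟩
    rintro _ ⟨x, rfl⟩
    exact (Proj.opensRange_awayι (grading k τ) _ (X_mem_grading k j) one_pos).ge
      (hG (x := x) trivial)
  obtain ⟨β₁, hβ₁⟩ := hfac G₁ h₁
  obtain ⟨β₂, hβ₂⟩ := hfac G₂ h₂
  suffices β₁ = β₂ by rw [← hβ₁, ← hβ₂, this]
  apply hom_spec_ext
  ext z
  obtain ⟨p, rfl⟩ := dehomogenize_surjective j z
  have key : ((Scheme.ΓSpecIso _).inv ≫ β₁.appTop).hom.comp (dehomogenize k j) =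
      ((Scheme.ΓSpecIso _).inv ≫ β₂.appTop).hom.comp (dehomogenize k j) := by
    refine MvPolynomial.ringHom_ext (fun c ↦ ?_) (fun i ↦ ?_)
    · have e (β : X ⟶ Spec (.of (HomogeneousLocalization.Away (grading k τ) (MvPolynomial.X j)))) :
          ((Scheme.ΓSpecIso _).inv ≫ β.appTop).hom (dehomogenize k j (MvPolynomial.C c)) =
            ((Scheme.ΓSpecIso (.of k)).inv ≫ ((β ≫ Proj.awayι (grading k τ) (MvPolynomial.X j)
              (X_mem_grading k j) one_pos) ≫ ProjSpace.toSpec k τ).appTop).hom c := by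
        rw [ProjSpace.toSpec, Category.assoc, Proj.awayι_toSpecZero_assoc, ← Spec.map_comp,
          Scheme.Hom.comp_appTop, ← Scheme.ΓSpecIso_inv_naturality_assoc]
        rw [dehomogenize, MvPolynomial.eval₂Hom_C]
        rfl
      rw [RingHom.comp_apply, RingHom.comp_apply, e, e, hβ₁, hβ₂, h]
    · have e (β : X ⟶ Spec (.of (HomogeneousLocalization.Away (grading k τ) (MvPolynomial.X j))))
          (G : X ⟶ ProjSpace k τ) (hG : ⊤ ≤ G ⁻¹ᵁ chart k j) (hβ : β ≫ Proj.awayι (grading k τ)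
            (MvPolynomial.X j) (X_mem_grading k j) one_pos = G) :
          ((Scheme.ΓSpecIso _).inv ≫ β.appTop).hom (dehomogenize k j (MvPolynomial.X i)) =
            (G.appLE _ ⊤ hG).hom (ratio k i j) := by
        refine Eq.trans ?_ (appLE_awayToSection _ (X_mem_grading k j) one_pos β G hβ ⊤ hG _).symm
        rw [dehomogenize, MvPolynomial.eval₂Hom_X']
        change ((Scheme.ΓSpecIso _).inv ≫ β.app ⊤).hom _ = _
        rw [Scheme.Hom.app_eq_appLE]
        rfl
      rw [RingHom.comp_apply, RingHom.comp_apply, e β₁ G₁ h₁ hβ₁, e β₂ G₂ h₂ hβ₂, H]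
  exact congr($key p)

variable (e : MvPolynomial τ k →+* Γ(X, ⊤))
  (he : (HomogeneousIdeal.irrelevant (grading k τ)).toIdeal.map e = ⊤)

lemma fromOfGlobalSections_preimage_chart (j : τ) :
    Proj.fromOfGlobalSections (grading k τ) e he ⁻¹ᵁ chart k j =
      X.basicOpen (e (MvPolynomial.X j)) :=
  Proj.fromOfGlobalSections_preimage_basicOpen _ _ _ one_pos (X_mem_grading k j)

/-- On the locus where `T_j` is invertible, the pullback of `x_i / x_j` along `[T]` is
`T_i / T_j`. -/
lemma fromOfGlobalSections_ratio (i j : τ) {P : X.Opens}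
    (hP : P ≤ Proj.fromOfGlobalSections (grading k τ) e he ⁻¹ᵁ chart k j) :
    (X.presheaf.map (homOfLE (le_top : P ≤ ⊤)).op).hom (e (MvPolynomial.X i)) =
      (X.presheaf.map (homOfLE (le_top : P ≤ ⊤)).op).hom (e (MvPolynomial.X j)) *
        ((Proj.fromOfGlobalSections (grading k τ) e he).appLE _ P hP).hom (ratio k i j) := by
  let t : MvPolynomial τ k := MvPolynomial.X j
  let G := Proj.fromOfGlobalSections (grading k τ) e he
  let B := X.basicOpen (e t)
  let φ : Localization.Away t →+* Localization.Away (e t) :=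
    IsLocalization.map (M := .powers t) (T := .powers (e t)) _ e
      (by rw [← Submonoid.map_le_iff_le_comap, Submonoid.map_powers])
  have hφ (p : MvPolynomial τ k) : φ (algebraMap _ _ p) = algebraMap _ _ (e p) :=
    IsLocalization.map_eq _ p
  let ψ := φ.comp (algebraMap (HomogeneousLocalization.Away (grading k τ) t) (Localization.Away t))
  obtain ⟨m, hm₁, hm₂⟩ : ∃ m : B.toScheme ⟶ Spec (.of (Localization.Away (e t))),
      m ≫ Spec.map (CommRingCat.ofHom (algebraMap Γ(X, ⊤) _)) = B.ι ≫ X.toSpecΓ ∧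
      (m ≫ Spec.map (CommRingCat.ofHom ψ)) ≫
        Proj.awayι (grading k τ) t (X_mem_grading k j) one_pos = B.ι ≫ G := by
    refine ⟨(X.isoOfEq (X.toSpecΓ_preimage_basicOpen (e t))).inv ≫ X.toSpecΓ ∣_ _ ≫
      (basicOpenIsoSpecAway _).hom, ?_, ?_⟩
    · simp only [Category.assoc, basicOpenIsoSpecAway_hom_SpecMap]
      refine (Iso.inv_comp_eq _).mpr ((morphismRestrict_ι _ _).trans ?_)
      rw [Scheme.isoOfEq_hom_ι_assoc]
    · have h1 := congr($(Proj.fromOfGlobalSections_resLE (grading k τ) e he one_pos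
        (X_mem_grading k j)) ≫ (chart k j).ι)
      rw [Scheme.Hom.resLE_comp_ι] at h1
      refine Eq.trans ?_ h1.symm
      simp only [Proj.toBasicOpenOfGlobalSections, Category.assoc, Proj.basicOpenIsoSpec_inv_ι]
      rfl
  have hB : B ≤ G ⁻¹ᵁ chart k j := (fromOfGlobalSections_preimage_chart e he j).ge
  have hPB : P ≤ B := hP.trans (fromOfGlobalSections_preimage_chart e he j).le
  have hBG : ⊤ ≤ (B.ι ≫ G) ⁻¹ᵁ chart k j := fun x _ ↦ hB x.2
  let χ := ((Scheme.ΓSpecIso (.of (Localization.Away (e t)))).inv ≫ m.appTop).hom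
  have h1 : ((B.ι ≫ G).appLE _ ⊤ hBG).hom (ratio k i j) = χ (ψ (awayRatio k i j)) := by
    refine (appLE_awayToSection _ (X_mem_grading k j) one_pos _ _ hm₂ ⊤ hBG _).trans ?_
    rw [appLE_top_top, Scheme.Hom.comp_appTop]
    exact congr(($(Scheme.ΓSpecIso_inv_naturality (CommRingCat.ofHom ψ)) ≫ m.appTop).hom
      (awayRatio k i j)).symm
  have h2 (z : Γ(X, ⊤)) : χ (algebraMap _ _ z) = B.ι.appTop.hom z := by
    have h := congr((Scheme.ΓSpecIso Γ(X, ⊤)).inv ≫ Scheme.Hom.appTop $hm₁)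
    rw [Scheme.Hom.comp_appTop, ← Scheme.ΓSpecIso_inv_naturality_assoc, Scheme.Hom.comp_appTop,
      Scheme.toSpecΓ_appTop, Iso.inv_hom_id_assoc] at h
    exact congr($(h).hom z)
  have h3 : χ (algebraMap _ _ (e t)) * χ (ψ (awayRatio k i j)) =
      χ (algebraMap _ _ (e (MvPolynomial.X i))) := by
    rw [← map_mul, ← hφ, ← hφ]
    change χ (_ * φ (awayRatio k i j).val) = _
    rw [← map_mul, val_awayRatio]
  rw [h2, h2, ← h1] at h3
  have h4 : (X.presheaf.map (homOfLE (le_top : B ≤ ⊤)).op).hom (e (MvPolynomial.X i)) =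
      (X.presheaf.map (homOfLE (le_top : B ≤ ⊤)).op).hom (e t) *
        (G.appLE _ B hB).hom (ratio k i j) := by
    have hι : ⊤ ≤ B.ι ⁻¹ᵁ B := fun x _ ↦ x.2
    have e1 : B.ι.appLE B ⊤ hι = B.topIso.inv := Scheme.Opens.ι_appLE _ _ _ hι
    have e2 (z : Γ(X, ⊤)) : (B.ι.appLE B ⊤ hι).hom
        ((X.presheaf.map (homOfLE (le_top : B ≤ ⊤)).op).hom z) = B.ι.appTop.hom z := by
      rw [← CommRingCat.comp_apply, Scheme.Hom.map_appLE, appLE_top_top]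
    have hinj : Function.Injective (B.ι.appLE B ⊤ hι).hom := by
      rw [e1]
      exact (ConcreteCategory.bijective_of_isIso B.topIso.inv).1
    apply hinj
    rw [map_mul, e2, e2, ← h3, ← CommRingCat.comp_apply, Scheme.Hom.appLE_comp_appLE]
  have h5 := congr((X.presheaf.map (homOfLE hPB).op).hom $h4)
  rw [map_mul, res_res, res_res, ← CommRingCat.comp_apply, Scheme.Hom.appLE_map] at h5
  exact h5

lemma toSpecΓ_specMap_scalars (t : X ⟶ Spec (.of k)) :
    X.toSpecΓ ≫ Spec.map (CommRingCat.ofHom (scalars t)) = t := by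
  apply hom_spec_ext
  rw [Scheme.Hom.comp_appTop, ← Scheme.ΓSpecIso_inv_naturality_assoc, Scheme.toSpecΓ_appTop,
    Iso.inv_hom_id, Category.comp_id]
  rfl

lemma fromOfGlobalSections_toSpec (t : X ⟶ Spec (.of k)) (T : τ → Γ(X, ⊤))
    (h : (HomogeneousIdeal.irrelevant (grading k τ)).toIdeal.map
      (MvPolynomial.eval₂Hom (scalars t) T) = ⊤) :
    Proj.fromOfGlobalSections (grading k τ) (MvPolynomial.eval₂Hom (scalars t) T) h ≫
      ProjSpace.toSpec k τ = t := by
  rw [ProjSpace.toSpec, Proj.fromOfGlobalSections_toSpecZero_assoc, ← Spec.map_comp,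
    ← CommRingCat.ofHom_comp]
  refine Eq.trans ?_ (toSpecΓ_specMap_scalars t)
  congr 3
  ext c
  exact MvPolynomial.eval₂Hom_C _ _ c

lemma IsLift.ratio_eq {t : X ⟶ Spec (.of k)} {G : X ⟶ ProjSpace k τ} {T : τ → Γ(X, ⊤)}
    (hT : IsLift t G T) (i j : τ) {P : X.Opens} (hP : P ≤ G ⁻¹ᵁ chart k j) :
    (X.presheaf.map (homOfLE (le_top : P ≤ ⊤)).op).hom (T i) =
      (X.presheaf.map (homOfLE (le_top : P ≤ ⊤)).op).hom (T j) *
        (G.appLE _ P hP).hom (ratio k i j) := by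
  obtain ⟨h, rfl⟩ := hT
  have := fromOfGlobalSections_ratio _ h i j hP
  rwa [MvPolynomial.eval₂Hom_X', MvPolynomial.eval₂Hom_X'] at this

/-- A morphism into the chart `D₊(x_j)` has the lift `T_i = G^* (x_i / x_j)`. -/
lemma isLift_ratio {t : X ⟶ Spec (.of k)} {G : X ⟶ ProjSpace k τ}
    (hG : G ≫ ProjSpace.toSpec k τ = t) (j : τ) (hj : ⊤ ≤ G ⁻¹ᵁ chart k j) :
    IsLift t G (fun i ↦ (G.appLE _ ⊤ hj).hom (ratio k i j)) := by
  set T : τ → Γ(X, ⊤) := fun i ↦ (G.appLE _ ⊤ hj).hom (ratio k i j) with hTdef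
  have hTj : T j = 1 := by rw [hTdef]; simp only [ratio_self, map_one]
  have h : (HomogeneousIdeal.irrelevant (grading k τ)).toIdeal.map
      (MvPolynomial.eval₂Hom (scalars t) T) = ⊤ := by
    rw [Ideal.eq_top_iff_one, ← hTj, ← MvPolynomial.eval₂Hom_X' (scalars t) T j]
    refine Ideal.mem_map_of_mem _ ?_
    rw [HomogeneousIdeal.mem_iff, HomogeneousIdeal.mem_irrelevant_iff, GradedRing.proj_apply]
    exact DirectSum.decompose_of_mem_ne _ (X_mem_grading k j) one_ne_zero
  have hle : ⊤ ≤ Proj.fromOfGlobalSections (grading k τ) (MvPolynomial.eval₂Hom (scalars t) T) h ⁻¹ᵁ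
      chart k j := by
    refine le_trans ?_ (fromOfGlobalSections_preimage_chart _ h j).ge
    rw [MvPolynomial.eval₂Hom_X', hTj, Scheme.basicOpen_of_isUnit _ isUnit_one]
  refine ⟨h, hom_ext_of_ratio j hj hle (hG.trans (fromOfGlobalSections_toSpec t T h).symm)
    fun i ↦ ?_⟩
  have h1 := fromOfGlobalSections_ratio _ h i j hle
  rw [MvPolynomial.eval₂Hom_X', MvPolynomial.eval₂Hom_X', hTj, map_one, one_mul] at h1
  rw [← h1]
  have h2 : homOfLE (le_top : (⊤ : X.Opens) ≤ ⊤) = 𝟙 _ := rfl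
  rw [h2, op_id, CategoryTheory.Functor.map_id]
  rfl

/-- For a lift `T` of `G`, a form of degree `m` evaluates at `T` to `T_j ^ m` times its value in
the chart `D₊(x_j)`. -/
lemma IsLift.eval₂Hom_eq {t : X ⟶ Spec (.of k)} {G : X ⟶ ProjSpace k τ} {T : τ → Γ(X, ⊤)}
    (hT : IsLift t G T) {Q : Scheme.{u}} (a : X ⟶ Q) {U : Q.Opens} (hU : ⊤ ≤ a ⁻¹ᵁ U) (j : τ)
    {P : X.Opens} (h₁ : P ≤ a ⁻¹ᵁ U) (h₂ : P ≤ G ⁻¹ᵁ chart k j) {m : ℕ}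
    {Θ : MvPolynomial τ Γ(Q, U)} (hΘ : Θ.IsHomogeneous m) :
    (X.presheaf.map (homOfLE (le_top : P ≤ ⊤)).op).hom
      (MvPolynomial.eval₂Hom (a.appLE U ⊤ hU).hom T Θ) =
      (X.presheaf.map (homOfLE (le_top : P ≤ ⊤)).op).hom (T j) ^ m *
        evalForm a G U j P h₁ h₂ Θ := by
  have e : ((X.presheaf.map (homOfLE (le_top : P ≤ ⊤)).op).hom.comp
      (MvPolynomial.eval₂Hom (a.appLE U ⊤ hU).hom T)) =
      MvPolynomial.eval₂Hom (a.appLE U P h₁).hom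
        (fun i ↦ (X.presheaf.map (homOfLE (le_top : P ≤ ⊤)).op).hom (T i)) := by
    refine MvPolynomial.ringHom_ext (fun c ↦ ?_) (fun i ↦ ?_)
    · rw [RingHom.comp_apply, MvPolynomial.eval₂Hom_C, MvPolynomial.eval₂Hom_C,
        ← CommRingCat.comp_apply, Scheme.Hom.appLE_map]
    · rw [RingHom.comp_apply, MvPolynomial.eval₂Hom_X', MvPolynomial.eval₂Hom_X']
  refine congr($e Θ).trans ?_
  exact eval₂Hom_of_isHomogeneous _ _ _ _ (fun i ↦ hT.ratio_eq i j h₂) hΘ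

end Lifts

/-! ### Contraction with tensors, vanishing on the graph, and apolarity -/

section Tensor

variable {A B : Type u} [CommRing A] [CommRing B] {σ : Type} {d : ℕ}

lemma tensor_monomial (T : DegIdx σ d → A) (a : DegIdx σ d) (c : A) :
    tensor T (MvPolynomial.monomial a.1 c) = c * T a := by
  have h : MvPolynomial.monomial a.1 c = c • MvPolynomial.basisMonomials σ A a.1 := by
    rw [MvPolynomial.coe_basisMonomials, MvPolynomial.smul_monomial, smul_eq_mul, mul_one]
  rw [h, map_smul, tensor, Module.Basis.constr_basis, dif_pos a.2, smul_eq_mul]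

lemma tensor_monomial_of_ne (T : DegIdx σ d → A) {a : σ →₀ ℕ} (ha : a.degree ≠ d) (c : A) :
    tensor T (MvPolynomial.monomial a c) = 0 := by
  have h : MvPolynomial.monomial a c = c • MvPolynomial.basisMonomials σ A a := by
    rw [MvPolynomial.coe_basisMonomials, MvPolynomial.smul_monomial, smul_eq_mul, mul_one]
  rw [h, map_smul, tensor, Module.Basis.constr_basis, dif_neg ha, smul_zero]

lemma tensor_of_isHomogeneous_of_ne (T : DegIdx σ d → A) {m : ℕ} (hm : m ≠ d)
    {p : MvPolynomial σ A} (hp : p.IsHomogeneous m) : tensor T p = 0 := by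
  rw [p.as_sum, map_sum]
  refine Finset.sum_eq_zero fun b hb ↦ tensor_monomial_of_ne T (fun h ↦ hm ?_) _
  by_contra hne
  exact MvPolynomial.mem_support_iff.mp hb (hp.coeff_eq_zero (h.trans_ne (Ne.symm hne)))

/-- The value of a linear form `Λ` in the `y_a` at the point `T` is the value of the functional
`∑ a, T a • x^(a)` at the form `Λ(α ^ a)` of degree `d`. -/
lemma eval₂Hom_eq_tensor (ρ : A →+* B) (T : DegIdx σ d → B) {Λ : MvPolynomial (DegIdx σ d) A}
    (hΛ : Λ.IsHomogeneous 1) :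
    MvPolynomial.eval₂Hom ρ T Λ = tensor T (MvPolynomial.map ρ (veroneseForm A σ d Λ)) := by
  have hmem : Λ ∈ Submodule.span A (Set.range MvPolynomial.X) := by
    rw [← MvPolynomial.homogeneousSubmodule_one_eq_span_X]
    exact hΛ
  clear hΛ
  induction hmem using Submodule.span_induction with
  | mem x hx =>
    obtain ⟨a, rfl⟩ := hx
    rw [MvPolynomial.eval₂Hom_X', veroneseForm_X, MvPolynomial.map_monomial, tensor_monomial,
      map_one, one_mul]
  | zero => simp
  | add x y _ _ hx hy => rw [map_add, hx, hy, map_add, map_add, map_add]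
  | smul c x _ hx =>
    rw [MvPolynomial.smul_eq_C_mul, map_mul, hx, MvPolynomial.eval₂Hom_C,
      ← MvPolynomial.smul_eq_C_mul, map_smul, MvPolynomial.smul_eq_C_mul, map_mul,
      MvPolynomial.map_C, ← MvPolynomial.smul_eq_C_mul, map_smul, smul_eq_mul]

lemma exists_veroneseForm_eq {p : MvPolynomial σ A} (hp : p.IsHomogeneous d) :
    ∃ Λ : MvPolynomial (DegIdx σ d) A, Λ.IsHomogeneous 1 ∧ veroneseForm A σ d Λ = p := by
  have hd (b : p.support) : b.1.degree = d := by
    by_contra h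
    exact MvPolynomial.mem_support_iff.mp b.2 (hp.coeff_eq_zero h)
  refine ⟨∑ b ∈ p.support.attach, p.coeff b.1 • MvPolynomial.X ⟨b.1, hd b⟩, ?_, ?_⟩
  · refine MvPolynomial.IsHomogeneous.sum _ _ _ fun b _ ↦ ?_
    rw [MvPolynomial.smul_eq_C_mul]
    simpa using (MvPolynomial.isHomogeneous_C _ _).mul (MvPolynomial.isHomogeneous_X A _)
  · rw [map_sum]
    conv_rhs => rw [p.as_sum, ← Finset.sum_attach]
    refine Finset.sum_congr rfl fun b _ ↦ ?_
    rw [map_smul, veroneseForm_X, MvPolynomial.smul_monomial, smul_eq_mul, mul_one]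

lemma veroneseForm_isHomogeneous {m : ℕ} {Λ : MvPolynomial (DegIdx σ d) A}
    (hΛ : Λ.IsHomogeneous m) : (veroneseForm A σ d Λ).IsHomogeneous (d * m) :=
  hΛ.aeval _ fun a ↦ MvPolynomial.isHomogeneous_monomial _ a.2

instance [Finite σ] : Finite (DegIdx σ d) := by
  classical
  have := Fintype.ofFinite σ
  refine Set.Finite.to_subtype ((Finset.finsuppAntidiag Finset.univ d).finite_toSet.subset ?_)
  intro a (ha : a.degree = d)
  rw [Finset.mem_coe, Finset.mem_finsuppAntidiag]
  exact ⟨by rw [← ha, Finsupp.degree_eq_sum], Finset.subset_univ _⟩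

end Tensor

section Main

variable {k : Type u} [Field k] {τ : Type} {Q T : Scheme.{u}} {s : Q ⟶ Spec (.of k)}

lemma vanishesOn_comp {T' : Scheme.{u}} (g : T' ⟶ T) (f : T ⟶ RelProj s τ) (U : Q.Opens)
    {Θ : MvPolynomial τ Γ(Q, U)} (h : VanishesOn f U Θ) : VanishesOn (g ≫ f) U Θ := by
  intro j
  have h' := (app_relForm_eq_zero f U j Θ).mpr (h j)
  rw [← app_relForm_eq_zero]
  refine Eq.trans ?_ ((congrArg (g.app (f ⁻¹ᵁ relChart s U j)).hom h').trans (map_zero _))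
  exact congr($(Scheme.Hom.comp_app g f (relChart s U j)).hom _)

lemma graph_fst (F : Q ⟶ ProjSpace k τ) (hF : F ≫ ProjSpace.toSpec k τ = s) :
    graph s F hF ≫ pullback.fst _ _ = 𝟙 Q := pullback.lift_fst _ _ _

lemma graph_snd (F : Q ⟶ ProjSpace k τ) (hF : F ≫ ProjSpace.toSpec k τ = s) :
    graph s F hF ≫ pullback.snd _ _ = F := pullback.lift_snd _ _ _

lemma isClosedImmersion_graph (F : Q ⟶ ProjSpace k τ) (hF : F ≫ ProjSpace.toSpec k τ = s) :
    IsClosedImmersion (graph s F hF) := by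
  have : IsClosedImmersion (graph s F hF ≫ pullback.fst s (ProjSpace.toSpec k τ)) := by
    rw [graph_fst]
    infer_instance
  exact IsClosedImmersion.of_comp _ (pullback.fst s (ProjSpace.toSpec k τ))

/-- A quasi-compact morphism factors through the linear span as soon as the forms defining the
linear span vanish on it. -/
lemma exists_factor_linearSpan {T' : Scheme.{u}} (f : T ⟶ RelProj s τ) (g : T' ⟶ RelProj s τ)
    [QuasiCompact g]
    (H : ∀ (U : Q.affineOpens) (Θ : MvPolynomial τ Γ(Q, U)), Θ ∈ linearIdeal f U →
      VanishesOn g U Θ) : ∃ g', g' ≫ linearSpanι f = g := by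
  have hle : (linearSpanι f).ker ≤ g.ker := by
    refine le_of_eq_of_le (Scheme.IdealSheafData.ker_subschemeι _) ?_
    refine sInf_le fun U Θ hΘ _ j ↦ ?_
    rw [← app_relForm_eq_zero, subschemeι_app_eq_zero_iff]
    intro V hV
    rw [Scheme.Hom.ker_apply, RingHom.mem_ker, ← CommRingCat.comp_apply, Scheme.Hom.naturality,
      CommRingCat.comp_apply, (app_relForm_eq_zero g U j Θ).mpr (H U Θ hΘ j), map_zero]
  have : IsClosedImmersion (linearSpanι f) :=
    inferInstanceAs (IsClosedImmersion (Scheme.IdealSheafData.subschemeι _))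
  exact ⟨IsClosedImmersion.lift _ _ hle, IsClosedImmersion.lift_fac _ _ hle⟩

lemma restrictTo_eq_appLE {U U' : Q.Opens} (h : U' ≤ U) (h' : ⊤ ≤ U'.ι ⁻¹ᵁ U) :
    restrictTo h = (U'.ι.appLE U ⊤ h').hom := by
  have hι : ⊤ ≤ U'.ι ⁻¹ᵁ U' := fun x _ ↦ x.2
  have e1 : U'.ι.appLE U' ⊤ hι = U'.topIso.inv := Scheme.Opens.ι_appLE _ _ _ hι
  rw [restrictTo, ← e1, Scheme.Hom.map_appLE]

lemma injective_appLE_ι (U' : Q.Opens) (hι : ⊤ ≤ U'.ι ⁻¹ᵁ U') :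
    Function.Injective (U'.ι.appLE U' ⊤ hι).hom := by
  have e1 : U'.ι.appLE U' ⊤ hι = U'.topIso.inv := Scheme.Opens.ι_appLE _ _ _ hι
  rw [e1]
  exact (ConcreteCategory.bijective_of_isIso U'.topIso.inv).1

lemma top_le_ι_preimage {U U' : Q.Opens} (h : U' ≤ U) : ⊤ ≤ U'.ι ⁻¹ᵁ U := fun x _ ↦ h x.2

/-- A form vanishing on the graph of `F` vanishes at every lift of `F` to affine space. -/
lemma eval₂Hom_eq_zero_of_vanishesOn_graph (F : Q ⟶ ProjSpace k τ)
    (hF : F ≫ ProjSpace.toSpec k τ = s) {U U' : Q.Opens} (h : U' ≤ U) {S : τ → Γ(U', ⊤)}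
    (hS : IsLift (U'.ι ≫ s) (U'.ι ≫ F) S) {m : ℕ} {Θ : MvPolynomial τ Γ(Q, U)}
    (hΘ : Θ.IsHomogeneous m) (hv : VanishesOn (graph s F hF) U Θ) :
    MvPolynomial.eval₂Hom (restrictTo h) S Θ = 0 := by
  rw [restrictTo_eq_appLE h (top_le_ι_preimage h)]
  have hv' := vanishesOn_comp U'.ι _ U hv
  rw [vanishesOn_iff_of_eq _ (a := U'.ι) (b := U'.ι ≫ F)
    (by rw [Category.assoc, graph_fst, Category.comp_id])
    (by rw [Category.assoc, graph_snd])] at hv'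
  refine U'.toScheme.IsSheaf.section_ext fun x _ ↦ ?_
  obtain ⟨j, hj⟩ := exists_mem_preimage_chart (U'.ι ≫ F) x
  refine ⟨(U'.ι ≫ F) ⁻¹ᵁ chart k j, le_top, hj, ?_⟩
  rw [map_zero]
  refine (hS.eval₂Hom_eq U'.ι (top_le_ι_preimage h) j (le_top.trans (top_le_ι_preimage h)) le_rfl
    hΘ).trans ?_
  rw [hv', mul_zero]

/-- Conversely, a form which vanishes at all local lifts of `F` vanishes on the graph of `F`. -/
lemma vanishesOn_graph_of_eval₂Hom_eq_zero (F : Q ⟶ ProjSpace k τ)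
    (hF : F ≫ ProjSpace.toSpec k τ = s) {U : Q.Opens} {Θ : MvPolynomial τ Γ(Q, U)}
    (H : ∀ (U' : Q.Opens) (h : U' ≤ U) (j : τ) (S : τ → Γ(U', ⊤)), S j = 1 →
      IsLift (U'.ι ≫ s) (U'.ι ≫ F) S → MvPolynomial.eval₂Hom (restrictTo h) S Θ = 0) :
    VanishesOn (graph s F hF) U Θ := by
  rw [vanishesOn_iff_of_eq _ (graph_fst F hF) (graph_snd F hF)]
  intro j P h₁ h₂
  have hP : P ≤ U := h₁
  have hPF : ⊤ ≤ (P.ι ≫ F) ⁻¹ᵁ chart k j := fun x _ ↦ h₂ x.2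
  have hS := isLift_ratio (G := P.ι ≫ F) (t := P.ι ≫ s) (by rw [Category.assoc, hF]) j hPF
  have h1 : ((P.ι ≫ F).appLE (chart k j) ⊤ hPF).hom (ratio k j j) = 1 := by
    rw [ratio_self, map_one]
  have h := H P hP j _ h1 hS
  rw [restrictTo_eq_appLE hP (top_le_ι_preimage hP)] at h
  have e := appLE_evalForm (𝟙 Q) F j h₁ h₂ P.ι (top_le_ι_preimage le_rfl) (top_le_ι_preimage hP)
    hPF Θ
  apply injective_appLE_ι P (top_le_ι_preimage le_rfl)
  rw [map_zero, e]
  have key (a : P.toScheme ⟶ Q) (ha : a = P.ι) (h' : ⊤ ≤ a ⁻¹ᵁ U) :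
      evalForm a (P.ι ≫ F) U j ⊤ h' hPF Θ = 0 := by
    subst ha
    exact h
  exact key _ (Category.comp_id _) _

variable {σ : Type} {d : ℕ} {R : Scheme.{u}}

lemma isCompact_preChart_relVeronese [Finite σ] [IsLocallyNoetherian Q] (i : R ⟶ RelProj s σ)
    [IsImmersion i] (U : Q.affineOpens) (j : DegIdx σ d) :
    IsCompact (preChart (i ≫ relVeronese s σ d) U j : Set R) := by
  refine isCompact_of_le_preimage s i U fun x hx ↦ ?_
  have h : x ∈ ((i ≫ relVeronese s σ d) ≫ pullback.fst _ _) ⁻¹ᵁ U.1 := hx.1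
  rwa [relVeronese_fst] at h

/-- If the graph of `F` lies in the linear span of `ν_d(R)`, and `Θ` vanishes on `R`, then for each
monomial `α ^ b` either `Θ α ^ b` has degree different from `d`, or it is the restriction along the
Veronese map of a linear form that vanishes on `ν_d(R)`, hence on the graph. -/
theorem homogeneousIdeal_le_ann [Finite (DegIdx σ d)] (i : R ⟶ RelProj s σ)
    (hc : ∀ (U : Q.affineOpens) (j : DegIdx σ d),
      IsCompact (preChart (i ≫ relVeronese s σ d) U j : Set R))
    (F : Q ⟶ ProjSpace k (DegIdx σ d)) (hF : F ≫ ProjSpace.toSpec k (DegIdx σ d) = s)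
    (g : Q ⟶ linearSpan (i ≫ relVeronese s σ d))
    (hg : g ≫ linearSpanι (i ≫ relVeronese s σ d) = graph s F hF) (U : Q.affineOpens) :
    homogeneousIdeal i U ≤ ann s F U := by
  refine Ideal.span_le.mpr ?_
  rintro Θ ⟨⟨m, hm⟩, hv⟩ U' h S hS
  refine (MvPolynomial.basisMonomials σ _).ext fun b ↦ ?_
  have hp : (Θ * MvPolynomial.monomial b 1).IsHomogeneous (m + b.degree) :=
    hm.mul (MvPolynomial.isHomogeneous_monomial _ rfl)
  have hpv : VanishesOn i U (Θ * MvPolynomial.monomial b 1) :=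
    vanishesOn_of_mem_homogeneousIdeal i U
      (Ideal.mul_mem_right _ _ (Ideal.subset_span ⟨⟨m, hm⟩, hv⟩))
  have e : apolar (MvPolynomial.map (restrictTo h) Θ) (tensor S)
      (MvPolynomial.basisMonomials σ _ b) =
      tensor S (MvPolynomial.map (restrictTo h) (Θ * MvPolynomial.monomial b 1)) := by
    rw [apolar_apply, map_mul (MvPolynomial.map _), MvPolynomial.map_monomial, map_one,
      MvPolynomial.coe_basisMonomials]
  rw [e, LinearMap.zero_apply]
  generalize Θ * MvPolynomial.monomial b 1 = p at hp hpv
  by_cases hd : m + b.degree = d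
  · rw [hd] at hp
    obtain ⟨Λ, hΛ, rfl⟩ := exists_veroneseForm_eq hp
    rw [← eval₂Hom_eq_tensor _ _ hΛ]
    refine eval₂Hom_eq_zero_of_vanishesOn_graph F hF h hS hΛ ?_
    rw [← hg]
    refine vanishesOn_comp _ _ _ (vanishesOn_linearSpanι _ hc U ?_ hΛ)
    exact Ideal.subset_span ⟨Ideal.subset_span ⟨⟨1, hΛ⟩, vanishesOn_relVeronese i U hΛ hpv⟩, 1,
      le_rfl, hΛ⟩
  · exact tensor_of_isHomogeneous_of_ne S hd (hp.map _)

/-- If `I(R) ⊆ Ann(F)`, then a linear form vanishing on `ν_d(R)` comes from a form of degree `d` in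
`I(R)`. The latter annihilates the lifts of `F`, and this means that the linear form vanishes at
them. -/
theorem vanishesOn_graph_of_homogeneousIdeal_le_ann (i : R ⟶ RelProj s σ)
    (F : Q ⟶ ProjSpace k (DegIdx σ d)) (hF : F ≫ ProjSpace.toSpec k (DegIdx σ d) = s)
    (U : Q.affineOpens) (H : homogeneousIdeal i U ≤ ann s F U)
    {Θ : MvPolynomial (DegIdx σ d) Γ(Q, U)} (hΘ : Θ ∈ linearIdeal (i ≫ relVeronese s σ d) U) :
    VanishesOn (graph s F hF) U Θ := by
  refine vanishesOn_graph_of_eval₂Hom_eq_zero F hF fun U' h j S hj hS ↦ ?_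
  suffices linearIdeal (i ≫ relVeronese s σ d) U ≤
      RingHom.ker (MvPolynomial.eval₂Hom (restrictTo h) S) from this hΘ
  refine Ideal.span_le.mpr ?_
  rintro Θ ⟨hΘ, m, hm, hΘm⟩
  -- Multiplying by `y_j`, whose value at the lift is `1`, reduces degree `0` to degree `1`.
  have h1 : (Θ * MvPolynomial.X j ^ (1 - m)).IsHomogeneous 1 := by
    have := hΘm.mul ((MvPolynomial.isHomogeneous_X Γ(Q, U) j).pow (1 - m))
    rwa [one_mul, Nat.add_sub_cancel' hm] at this
  have h2 : veroneseForm _ σ d (Θ * MvPolynomial.X j ^ (1 - m)) ∈ homogeneousIdeal i U :=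
    Ideal.subset_span ⟨⟨_, veroneseForm_isHomogeneous h1⟩, vanishesOn_veroneseForm i U
      (vanishesOn_of_mem_homogeneousIdeal _ _ (Ideal.mul_mem_right _ _ hΘ))⟩
  have h3 := congr($(H h2 U' h S hS) 1)
  rw [apolar_apply, mul_one, ← eval₂Hom_eq_tensor _ _ h1, map_mul, map_pow,
    MvPolynomial.eval₂Hom_X', hj, one_pow, mul_one] at h3
  exact h3

end Main

end

end RelApolarity

theorem theorem4 {k : Type u} [Field k] [IsAlgClosed k] (n d : ℕ)
    {Q : Scheme.{u}} (s : Q ⟶ Spec (.of k)) (hQ : RelApolarity.HasEnoughPoints s)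
    (F : Q ⟶ RelApolarity.ProjSpace k (RelApolarity.DegIdx (Fin (n + 1)) d))
    (hF : F ≫ RelApolarity.ProjSpace.toSpec k (RelApolarity.DegIdx (Fin (n + 1)) d) = s)
    {R : Scheme.{u}} (i : R ⟶ RelApolarity.RelProj s (Fin (n + 1))) [IsImmersion i] :
    (∃ g : Q ⟶ RelApolarity.linearSpan (i ≫ RelApolarity.relVeronese s (Fin (n + 1)) d),
      g ≫ RelApolarity.linearSpanι (i ≫ RelApolarity.relVeronese s (Fin (n + 1)) d) =
        RelApolarity.graph s F hF) ↔
    ∀ U : Q.affineOpens, RelApolarity.homogeneousIdeal i U ≤ RelApolarity.ann s F U := by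
  have := hQ.isLocallyNoetherian
  constructor
  · rintro ⟨g, hg⟩ U
    exact RelApolarity.homogeneousIdeal_le_ann i
      (RelApolarity.isCompact_preChart_relVeronese i) F hF g hg U
  · intro H
    have := RelApolarity.isClosedImmersion_graph F hF
    exact RelApolarity.exists_factor_linearSpan _ _ fun U Θ hΘ ↦
      RelApolarity.vanishesOn_graph_of_homogeneousIdeal_le_ann i F hF U (H U) hΘ
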